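/- Let $G=(V,E)$ be a finite simple graph (a network). For every edge $e=\{v,w\}\in E$ a source hands one qubit to node $v$ and one qubit to node $w$, in the singlet state $|\Psi^-\rangle_e=(|01\rangle-|10\rangle)/\sqrt2$, so that the initial state of the network is $|\Psi\rangle=\bigotimes_{e\in E}|\Psi^-\rangle_e$; node $v$ acts on all the qubits it has received. A state is reachable if a finite-round LOCC protocol (a finite tree of rounds, in each of which one node performs a generalized measurement with finitely many outcomes and broadcasts the outcome, upon which the other nodes apply local isometries) transforms $|\Psi\rangle$ into it with certainty, up to a scalar factor. (a) Suppose that $G$ contains a cycle $C$. For each node $i$ of $C$ let $\alpha_i\in\mathbb R$ and let $h_i$ be an invertible operator on the qubits of node $i$ such that $$h_i^\dagger h_i=\Bigl(\tfrac14\mathbb 1+\alpha_i\,\sigma_z\otimes\sigma_z\Bigr)\otimes\mathbb 1 ,$$ where the first factor acts on the two qubits of node $i$ that belong to the edges of $C$ and the last identity acts on its remaining qubits. If $\prod_{i\in C}\alpha_i>0$, then the state $\bigl(\bigotimes_{i\in C}h_i\otimes\bigotimes_{j\notin C}\mathbb 1\bigr)|\Psi\rangle$ is not reachable. (b) In contrast,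 if $G$ is a tree, then for all invertible operators $h_v$ on the qubits of the nodes $v\in V$ the state $\bigl(\bigotimes_{v\in V}h_v\bigr)|\Psi\rangle$ is reachable. -/

import Mathlib

open scoped Matrix

universe u

noncomputable section

namespace QNetwork

/-! ### Multipartite states, local operators, finite-round LOCC

The parties are the elements of `V`; the local Hilbert space of party `v` has the computational
basis `ι v`.  A (not necessarily normalised) pure state is its family of amplitudes. -/

/-- Pure states of the parties `V` with local bases `ι v`. -/
abbrev PureState {V : Type u} (ι : V → Type u) : Type u := (∀ v, ι v) → ℂ

/-- The action of the local operator `⨂ᵥ M v` on a pure state. -/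
def applyLocal {V : Type u} [Fintype V] [DecidableEq V] {ι κ : V → Type u}
    [∀ v, Fintype (ι v)] (M : ∀ v, Matrix (κ v) (ι v) ℂ) (ψ : PureState ι) : PureState κ :=
  fun x => ∑ y : (∀ v, ι v), (∏ v, M v (x v) (y v)) * ψ y

open scoped Classical in
/-- `M` is an isometry (a unitary if it is square): `M† M = 1`. -/
def IsIsometry {ι κ : Type u} [Fintype κ] (M : Matrix κ ι ℂ) : Prop := Mᴴ * M = 1

open scoped Classical in
/-- The Kraus operators `K k` form a generalised measurement: `∑ₖ Kₖ† Kₖ = 1`. -/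
def IsMeasurement {ι : Type u} {m : ℕ} {κ : Fin m → Type u} [∀ k, Fintype (κ k)]
    (K : ∀ k, Matrix (κ k) ι ℂ) : Prop := ∑ k, (K k)ᴴ * K k = 1

/-- `LOCCTo φ ι _ ψ`: there is a finite LOCC protocol turning `ψ` deterministically into `φ`.
A protocol is a finite tree.  In one round (`round`) a party `v` performs a generalised measurement
with finitely many outcomes and broadcasts the outcome `k`; the other parties apply isometries that
may depend on `k` (the local spaces may change, so ancillas are allowed); the
protocol goes on from the unnormalised post-measurement state, its squared norm relative to that of
`ψ` being the probability of `k`.  Every branch has to end in the target `φ` up to a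
nonzero scalar (`done`), unless it occurs with probability zero (`impossible`). -/
inductive LOCCTo {V : Type u} [Fintype V] [DecidableEq V] {τ : V → Type u}
    [instτ : ∀ v, Fintype (τ v)] (φ : PureState τ) :
    ∀ (ι : V → Type u) (_ : ∀ v, Fintype (ι v)), PureState ι → Prop
  | done (a : ℂ) (ha : a ≠ 0) : LOCCTo φ τ instτ (a • φ)
  | impossible (ι : V → Type u) (inst : ∀ v, Fintype (ι v)) : LOCCTo φ ι inst 0
  | round (ι : V → Type u) (inst : ∀ v, Fintype (ι v)) (ψ : PureState ι)
      (v : V) (m : ℕ) (κ : Fin m → V → Type u) (inst' : ∀ k w, Fintype (κ k w))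
      (M : ∀ (k : Fin m) (w : V), Matrix (κ k w) (ι w) ℂ)
      (hmeas : IsMeasurement (fun k => M k v))
      (hiso : ∀ k w, w ≠ v → IsIsometry (M k w))
      (hnext : ∀ k, LOCCTo φ (κ k) (inst' k) (applyLocal (M k) ψ)) :
      LOCCTo φ ι inst ψ

/-- `φ` can be reached from `ψ` by a (deterministic) finite-round LOCC protocol. -/
def FiniteRoundLOCC {V : Type u} [Fintype V] [DecidableEq V] {ι τ : V → Type u}
    [instι : ∀ v, Fintype (ι v)] [∀ v, Fintype (τ v)]
    (ψ : PureState ι) (φ : PureState τ) : Prop :=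
  LOCCTo φ ι instι ψ

/-! ### Networks of two-qubit sources

A network is a finite simple graph `G`.  The source on the edge `{v, w}` hands one qubit to `v` and
one to `w`; the qubit of that edge held by `v` is labelled by the neighbour `w` of `v`. -/

/-- The computational basis of all the qubits held by node `v`: one bit per incident edge. -/
abbrev NodeBasis {V : Type u} (G : SimpleGraph V) (v : V) : Type u := G.neighborSet v → Fin 2

/-- Operators on all the qubits held by node `v`. -/
abbrev NodeOp {V : Type u} (G : SimpleGraph V) (v : V) : Type u :=
  Matrix (NodeBasis G v) (NodeBasis G v) ℂ

/-- The amplitudes of the singlet `|Ψ⁻⟩ = (|01⟩ - |10⟩) / √2`. -/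
def singlet : Matrix (Fin 2) (Fin 2) ℂ := ((Real.sqrt 2 : ℝ) : ℂ)⁻¹ • !![0, 1; -1, 0]

/-- The network state `⨂ₑ |Ψ⁻⟩ₑ`; the first qubit of each singlet is the one held by the smaller
end of the edge (another choice only changes a global sign). -/
def networkState {V : Type u} [Fintype V] [LinearOrder V] (G : SimpleGraph V)
    [DecidableRel G.Adj] : PureState (NodeBasis G) :=
  fun x => ∏ v, ∏ w : G.neighborSet v,
    if v < w.1 then singlet (x v w) (x w.1 ⟨v, G.adj_symm w.2⟩) else 1

/-- The Pauli matrix `σ_z`. -/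
def pauliZ : Matrix (Fin 2) (Fin 2) ℂ := !![1, 0; 0, -1]

/-- The operator `⨂_w A w` on the qubits of node `v`, one single-qubit factor per qubit. -/
def qubitTensor {V : Type u} [Fintype V] {G : SimpleGraph V} [DecidableRel G.Adj] {v : V}
    (A : G.neighborSet v → Matrix (Fin 2) (Fin 2) ℂ) : NodeOp G v :=
  Matrix.of fun x y => ∏ w, A w (x w) (y w)

/-- `1/4 + a σ_z ⊗ σ_z` on the two qubits of node `v` that belong to edges of the closed
walk `c` (a cycle through `v`), tensored with the identity on the other qubits of `v`. -/
def cycleOp {V : Type u} [Fintype V] [DecidableEq V] {G : SimpleGraph V} [DecidableRel G.Adj]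
    {s : V} (c : G.Walk s s) (v : V) (a : ℝ) : NodeOp G v :=
  (1 / 4 : ℂ) • (1 : NodeOp G v) +
    (a : ℂ) • qubitTensor (fun w => if s(v, w.1) ∈ c.edges then pauliZ else 1)

end QNetwork

end

/-! Both halves rest on the local symmetries of |Ψ⟩. Since A ⊗ A multiplies the singlet by det A,
the same invertible matrix on both qubits of an edge fixes |Ψ⟩ up to a scalar (`applyLocal_edgeOp`).
Conversely, every local operator fixing |Ψ⟩ up to a nonzero scalar is a product of such edge
operators and scalars (`exists_edgeOp_of_stabilizer`).

Cycle. A protocol is read from its leaves to its root, each state being written ⨂ A_v |Ψ⟩. The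
invariant (`orbit_of_LOCCTo`) is that the moduli A_v†A_v of a nonzero state are, up to scalars, the
moduli H_v of the target conjugated by one common edge operator. At a leaf this is the converse
above. In a round only the measuring node v changes its modulus, so the edge operators of two
branches differ by some Y that preserves H_w up to a scalar for all w ≠ v. Rigidity
(`two_qubit_rigidity`) makes Y a multiple of a unitary on each edge, commuting or anticommuting with
σ_z on the edges of the cycle, with signs of product 1 at every w ≠ v. Each edge contributes its
sign at both of its ends, so the signs have product 1 at v as well, and Y preserves H_v. Thus all
outcomes at v have proportional moduli, and the completeness relation carries the invariant to the
parent. At the root A_v = 1 would make H_v a product operator, which 1/4 + α σ_z ⊗ σ_z is not for α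
≠ 0.

Tree. The induction is on the set S of nodes with a nontrivial operator. A node w of S farthest from
some element of S has at most one neighbour p in S. It measures with Kraus operators h_w P, where P
runs over the Pauli strings on the qubits shared with nodes outside S; those nodes undo P by the
symmetry P ⊗ P. The sum of the P†h_w†h_w P acts on the qubit towards p only, and a symmetry B ⊗ B of
that edge normalises it to 1, at the price of changing the operator of p, which is arbitrary anyway
(`exists_gauge`). -/

namespace QNetwork

set_option linter.unusedSectionVars false

/-! ### Local operators and composition of protocols. -/

section Local

variable {V : Type u} [Fintype V] [DecidableEq V]

theorem applyLocal_comp {ι κ μ : V → Type u} [∀ v, Fintype (ι v)] [∀ v, Fintype (κ v)]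
    (N : ∀ v, Matrix (μ v) (κ v) ℂ) (M : ∀ v, Matrix (κ v) (ι v) ℂ) (ψ : PureState ι) :
    applyLocal N (applyLocal M ψ) = applyLocal (fun v => N v * M v) ψ := by
  funext x
  simp only [applyLocal, Matrix.mul_apply, Finset.prod_univ_sum, Fintype.piFinset_univ,
    Finset.mul_sum, Finset.sum_mul, Finset.prod_mul_distrib]
  rw [Finset.sum_comm]
  simp only [mul_assoc]

theorem applyLocal_one {ι : V → Type u} [∀ v, Fintype (ι v)] [∀ v, DecidableEq (ι v)]
    (ψ : PureState ι) : applyLocal (fun v => (1 : Matrix (ι v) (ι v) ℂ)) ψ = ψ := by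
  funext x
  rw [applyLocal, Finset.sum_eq_single x]
  · simp
  · intro y _ hy
    obtain ⟨v, hv⟩ := Function.ne_iff.1 hy
    have h0 : (1 : Matrix (ι v) (ι v) ℂ) (x v) (y v) = 0 := Matrix.one_apply_ne hv.symm
    exact mul_eq_zero_of_left (Finset.prod_eq_zero (Finset.mem_univ v) h0) _
  · simp

theorem applyLocal_smul {ι κ : V → Type u} [∀ v, Fintype (ι v)]
    (M : ∀ v, Matrix (κ v) (ι v) ℂ) (c : ℂ) (ψ : PureState ι) :
    applyLocal M (c • ψ) = c • applyLocal M ψ := by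
  funext x
  simp only [applyLocal, Pi.smul_apply, smul_eq_mul, Finset.mul_sum]
  exact Finset.sum_congr rfl fun y _ => by ring

theorem applyLocal_zero {ι κ : V → Type u} [∀ v, Fintype (ι v)]
    (M : ∀ v, Matrix (κ v) (ι v) ℂ) : applyLocal M (0 : PureState ι) = 0 := by
  funext x
  simp [applyLocal]

theorem applyLocal_eq_zero_of_factor {ι κ : V → Type u} [∀ v, Fintype (ι v)]
    (M : ∀ v, Matrix (κ v) (ι v) ℂ) (ψ : PureState ι) {v : V} (hv : M v = 0) :
    applyLocal M ψ = 0 := by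
  funext x
  refine Finset.sum_eq_zero fun y _ => ?_
  rw [Finset.prod_eq_zero (Finset.mem_univ v) (by rw [hv]; rfl), zero_mul]

theorem applyLocal_smul_factors {ι κ : V → Type u} [∀ v, Fintype (ι v)] (c : V → ℂ)
    (M : ∀ v, Matrix (κ v) (ι v) ℂ) (ψ : PureState ι) :
    applyLocal (fun v => c v • M v) ψ = (∏ v, c v) • applyLocal M ψ := by
  funext x
  simp only [applyLocal, Pi.smul_apply, smul_eq_mul, Finset.mul_sum, Matrix.smul_apply,
    Finset.prod_mul_distrib, mul_assoc]

theorem LOCCTo.smul {τ : V → Type u} [instτ : ∀ v, Fintype (τ v)] {φ : PureState τ}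
    {ι : V → Type u} {inst : ∀ v, Fintype (ι v)} {ψ : PureState ι} (h : LOCCTo φ ι inst ψ)
    {c : ℂ} (hc : c ≠ 0) : LOCCTo φ ι inst (c • ψ) := by
  induction h with
  | done a ha =>
    rw [smul_smul]
    exact .done _ (mul_ne_zero hc ha)
  | impossible ι inst =>
    rw [smul_zero]
    exact .impossible _ _
  | round ι inst ψ v m κ inst' M hmeas hiso _ ih =>
    refine .round ι inst _ v m κ inst' M hmeas hiso fun k => ?_
    rw [applyLocal_smul]
    exact ih k

/-- The second tree is grafted onto each leaf of the first, which carries a nonzero multiple of `φ`.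
-/
theorem LOCCTo.trans {τ τ' : V → Type u} [instτ : ∀ v, Fintype (τ v)]
    [instτ' : ∀ v, Fintype (τ' v)] {φ : PureState τ} {χ : PureState τ'}
    {ι : V → Type u} {inst : ∀ v, Fintype (ι v)} {ψ : PureState ι} (h : LOCCTo φ ι inst ψ)
    (h' : LOCCTo χ τ instτ φ) : LOCCTo χ ι inst ψ := by
  induction h with
  | done a ha => exact h'.smul ha
  | impossible ι inst => exact .impossible _ _
  | round ι inst ψ v m κ inst' M hmeas hiso _ ih =>
    exact .round ι inst _ v m κ inst' M hmeas hiso ih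

end Local

/-! ### Products of single-qubit operators. -/

section Tensor

variable {V : Type u} [Fintype V] {G : SimpleGraph V} [DecidableRel G.Adj] {v : V}

theorem qubitTensor_apply (A : G.neighborSet v → Matrix (Fin 2) (Fin 2) ℂ)
    (x y : NodeBasis G v) : qubitTensor A x y = ∏ w, A w (x w) (y w) := rfl

theorem qubitTensor_mul [DecidableEq V] (A B : G.neighborSet v → Matrix (Fin 2) (Fin 2) ℂ) :
    qubitTensor A * qubitTensor B = qubitTensor fun w => A w * B w := by
  ext x y
  simp only [Matrix.mul_apply, qubitTensor_apply, Finset.prod_univ_sum, Fintype.piFinset_univ,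
    Finset.prod_mul_distrib]

theorem qubitTensor_one :
    qubitTensor (fun _ : G.neighborSet v => (1 : Matrix (Fin 2) (Fin 2) ℂ)) = 1 := by
  ext x y
  simp only [qubitTensor_apply, Matrix.one_apply]
  by_cases h : x = y
  · simp [h]
  · obtain ⟨w, hw⟩ := Function.ne_iff.1 h
    rw [if_neg h, Finset.prod_eq_zero (Finset.mem_univ w) (if_neg hw)]

theorem qubitTensor_conjTranspose (A : G.neighborSet v → Matrix (Fin 2) (Fin 2) ℂ) :
    (qubitTensor A)ᴴ = qubitTensor fun w => (A w)ᴴ := by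
  ext x y
  simp [qubitTensor_apply, Matrix.conjTranspose_apply]

theorem qubitTensor_smul (c : G.neighborSet v → ℂ)
    (A : G.neighborSet v → Matrix (Fin 2) (Fin 2) ℂ) :
    (qubitTensor fun w => c w • A w) = (∏ w, c w) • qubitTensor A := by
  ext x y
  simp [qubitTensor_apply, Finset.prod_mul_distrib]

variable [DecidableEq V]

theorem qubitTensor_mul_inv {A : G.neighborSet v → Matrix (Fin 2) (Fin 2) ℂ}
    (hA : ∀ w, (A w).det ≠ 0) :
    qubitTensor A * qubitTensor (fun w => (A w)⁻¹) = 1 := by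
  rw [qubitTensor_mul, ← qubitTensor_one]
  congr 1
  funext w
  exact Matrix.mul_nonsing_inv _ (isUnit_iff_ne_zero.2 (hA w))

theorem isUnit_qubitTensor {A : G.neighborSet v → Matrix (Fin 2) (Fin 2) ℂ}
    (hA : ∀ w, (A w).det ≠ 0) : IsUnit (qubitTensor A) :=
  (Matrix.isUnit_iff_isUnit_det _).2 (Matrix.isUnit_det_of_right_inverse (qubitTensor_mul_inv hA))

/-- The operator at node `v` of a family of single-qubit operators indexed by edges, acting in the
same way on both qubits of each edge. -/
noncomputable def edgeOp (X : Sym2 V → Matrix (Fin 2) (Fin 2) ℂ) (v : V) : NodeOp G v :=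
  qubitTensor fun w => X s(v, w.1)

theorem edgeOp_mul (X Y : Sym2 V → Matrix (Fin 2) (Fin 2) ℂ) (v : V) :
    (edgeOp X v * edgeOp Y v : NodeOp G v) = edgeOp (fun e => X e * Y e) v :=
  qubitTensor_mul _ _

theorem edgeOp_one (v : V) : (edgeOp (fun _ => 1) v : NodeOp G v) = 1 := qubitTensor_one

theorem isUnit_edgeOp {X : Sym2 V → Matrix (Fin 2) (Fin 2) ℂ} (hX : ∀ e, (X e).det ≠ 0) (v : V) :
    IsUnit (edgeOp X v : NodeOp G v) :=
  isUnit_qubitTensor fun _ => hX _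

end Tensor

/-! ### Amplitudes and symmetries of the network state. -/

theorem singlet_self (p : Fin 2) : singlet p p = 0 := by
  fin_cases p <;> simp [singlet]

theorem singlet_swap (p q : Fin 2) : singlet q p = -singlet p q := by
  fin_cases p <;> fin_cases q <;> simp [singlet]

theorem singlet_ne_zero {p q : Fin 2} (h : p ≠ q) : singlet p q ≠ 0 := by
  fin_cases p <;> fin_cases q <;> simp_all [singlet]

section

variable {V : Type u} [Fintype V] [LinearOrder V] {G : SimpleGraph V} [DecidableRel G.Adj]

/-- The basis configuration obtained from `x` by resetting the two qubits of the edge `{v, w}`. -/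
def setEdge (x : ∀ u, NodeBasis G u) (v w : V) (p q : Fin 2) : ∀ u, NodeBasis G u :=
  fun a b => if a = v ∧ b.1 = w then p else if a = w ∧ b.1 = v then q else x a b

theorem setEdge_left (x : ∀ u, NodeBasis G u) {v w : V} (h : G.Adj v w) (p q : Fin 2) :
    setEdge x v w p q v = Function.update (x v) ⟨w, h⟩ p := by
  funext b
  by_cases hb : b = ⟨w, h⟩
  · subst hb
    simp [setEdge]
  · have : b.1 ≠ w := fun e => hb (Subtype.ext e)
    simp [setEdge, hb, this, h.ne]

theorem setEdge_swap (x : ∀ u, NodeBasis G u) {v w : V} (h : G.Adj v w) (p q : Fin 2) :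
    setEdge x v w p q = setEdge x w v q p := by
  funext a b
  simp only [setEdge]
  have := h.ne
  by_cases h1 : a = v <;> by_cases h2 : a = w <;> simp_all

theorem setEdge_right (x : ∀ u, NodeBasis G u) {v w : V} (h : G.Adj v w) (p q : Fin 2) :
    setEdge x v w p q w = Function.update (x w) ⟨v, h.symm⟩ q := by
  rw [setEdge_swap x h, setEdge_left _ h.symm]

theorem setEdge_of_ne (x : ∀ u, NodeBasis G u) {v w u : V} (p q : Fin 2) (hv : u ≠ v)
    (hw : u ≠ w) : setEdge x v w p q u = x u := by
  funext b
  simp [setEdge, hv, hw]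

theorem setEdge_self (x : ∀ u, NodeBasis G u) {v w : V} (h : G.Adj v w) :
    setEdge x v w (x v ⟨w, h⟩) (x w ⟨v, h.symm⟩) = x := by
  funext u
  by_cases hv : u = v
  · subst hv
    rw [setEdge_left _ h, Function.update_eq_self]
  by_cases hw : u = w
  · subst hw
    rw [setEdge_right _ h, Function.update_eq_self]
  exact setEdge_of_ne _ _ _ hv hw

theorem setEdge_injective (x : ∀ u, NodeBasis G u) {v w : V} (h : G.Adj v w) :
    Function.Injective fun s : Fin 2 × Fin 2 => setEdge x v w s.1 s.2 := by
  intro s t hst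
  have h1 := congrFun (congrFun hst v) ⟨w, h⟩
  have h2 := congrFun (congrFun hst w) ⟨v, h.symm⟩
  simp only [setEdge_left x h, setEdge_right x h, Function.update_self] at h1 h2
  exact Prod.ext h1 h2

theorem networkState_setEdge_of_lt (x : ∀ u, NodeBasis G u) {v w : V} (h : G.Adj v w)
    (hlt : v < w) : ∃ K : ℂ, ∀ p q, networkState G (setEdge x v w p q) = singlet p q * K := by
  have key : ∀ (p q : Fin 2) (a : V) (b : G.neighborSet a), ¬ (a = v ∧ b.1 = w) →
      (if a < b.1 then singlet (setEdge x v w p q a b)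
        (setEdge x v w p q b.1 ⟨a, G.adj_symm b.2⟩) else 1) =
      if a < b.1 then singlet (x a b) (x b.1 ⟨a, G.adj_symm b.2⟩) else 1 := by
    intro p q a b hab
    split_ifs with hlt'
    · have h2 : ¬ (a = w ∧ b.1 = v) := by
        rintro ⟨rfl, hb⟩
        rw [hb] at hlt'
        exact lt_asymm hlt hlt'
      have h3 : ¬ (b.1 = v ∧ a = w) := fun hh => h2 hh.symm
      have h4 : ¬ (b.1 = w ∧ a = v) := fun hh => hab hh.symm
      simp only [setEdge, if_neg hab, if_neg h2, if_neg h3, if_neg h4]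
    · rfl
  refine ⟨(∏ b ∈ Finset.univ.erase (⟨w, h⟩ : G.neighborSet v),
      if v < b.1 then singlet (x v b) (x b.1 ⟨v, G.adj_symm b.2⟩) else 1) *
    ∏ a ∈ Finset.univ.erase v, ∏ b : G.neighborSet a,
      if a < b.1 then singlet (x a b) (x b.1 ⟨a, G.adj_symm b.2⟩) else 1, fun p q => ?_⟩
  rw [networkState, ← Finset.mul_prod_erase _ _ (Finset.mem_univ v),
    ← Finset.mul_prod_erase _ _ (Finset.mem_univ (⟨w, h⟩ : G.neighborSet v)), mul_assoc]
  congr 1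
  · rw [if_pos hlt, setEdge_left x h, setEdge_right x h, Function.update_self,
      Function.update_self]
  congr 1
  · refine Finset.prod_congr rfl fun b hb => key p q v b ?_
    rintro ⟨-, hb'⟩
    exact (Finset.mem_erase.1 hb).1 (Subtype.ext hb')
  · refine Finset.prod_congr rfl fun a ha => Finset.prod_congr rfl fun b _ => key p q a b ?_
    rintro ⟨ha', -⟩
    exact (Finset.mem_erase.1 ha).1 ha'

theorem networkState_setEdge (x : ∀ u, NodeBasis G u) {v w : V} (h : G.Adj v w) :
    ∃ K : ℂ, ∀ p q, networkState G (setEdge x v w p q) = singlet p q * K := by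
  rcases lt_or_gt_of_ne h.ne with hlt | hlt
  · exact networkState_setEdge_of_lt x h hlt
  · obtain ⟨K, hK⟩ := networkState_setEdge_of_lt x h.symm hlt
    refine ⟨-K, fun p q => ?_⟩
    rw [setEdge_swap x h, hK, singlet_swap p q]
    ring

theorem networkState_eq_zero_of_eq {x : ∀ u, NodeBasis G u} {v w : V} (h : G.Adj v w)
    (hx : x v ⟨w, h⟩ = x w ⟨v, h.symm⟩) : networkState G x = 0 := by
  obtain ⟨K, hK⟩ := networkState_setEdge x h
  rw [← setEdge_self x h, hK, hx, singlet_self, zero_mul]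

theorem networkState_ne_zero {x : ∀ u, NodeBasis G u}
    (hx : ∀ v w (h : G.Adj v w), x v ⟨w, h⟩ ≠ x w ⟨v, h.symm⟩) : networkState G x ≠ 0 := by
  refine Finset.prod_ne_zero_iff.2 fun v _ => Finset.prod_ne_zero_iff.2 fun w _ => ?_
  split_ifs
  · exact singlet_ne_zero (hx v w.1 w.2)
  · exact one_ne_zero

/-- There is a configuration of nonzero amplitude with prescribed qubits at `v`, and with
prescribed qubits at `w` up to the one that belongs to the edge `{v, w}`. -/
theorem exists_networkState_ne_zero (v w : V) (b : NodeBasis G v) (b' : NodeBasis G w) :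
    ∃ z : ∀ u, NodeBasis G u,
      (∀ a a' (h : G.Adj a a'), z a ⟨a', h⟩ ≠ z a' ⟨a, h.symm⟩) ∧ z v = b ∧
      (v ≠ w → ∀ u : G.neighborSet w, u.1 ≠ v → z w u = b' u) := by
  classical
  let e : Fin 2 → Fin 2 := fun i => 1 - i
  have he : ∀ i, e i ≠ i := by decide
  -- Prescribed qubits keep their values and their partners get the opposite bit; every other edge
  -- has 0 at its smaller end and 1 at its larger one.
  let z : ∀ u, NodeBasis G u := fun a c =>
    if ha : a = v then b ⟨c.1, ha ▸ c.2⟩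
    else if hc : c.1 = v then e (b ⟨a, hc ▸ G.adj_symm c.2⟩)
    else if ha : a = w then b' ⟨c.1, ha ▸ c.2⟩
    else if hc : c.1 = w then e (b' ⟨a, hc ▸ G.adj_symm c.2⟩)
    else if a < c.1 then 0 else 1
  refine ⟨z, ?_, ?_, ?_⟩
  · intro a a' h
    have hne := h.ne
    have he' : ∀ i, i ≠ e i := fun i => (he i).symm
    simp only [z]
    by_cases h1 : a = v
    · have h2 : a' ≠ v := fun hh => hne (h1.trans hh.symm)
      simp [h1, h2, he']
    by_cases h2 : a' = v
    · simp [h1, h2, he]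
    by_cases h3 : a = w
    · have h4 : a' ≠ w := fun hh => hne (h3.trans hh.symm)
      have h5 : w ≠ v := h3 ▸ h1
      simp [h2, h3, h4, h5, he']
    by_cases h4 : a' = w
    · have h5 : w ≠ v := h4 ▸ h2
      simp [h1, h3, h4, h5, he]
    rcases lt_or_gt_of_ne hne with hlt | hlt
    · simp [h1, h2, h3, h4, hlt, hlt.not_gt]
    · simp [h1, h2, h3, h4, hlt, hlt.not_gt]
  · funext c
    simp [z]
  · intro hvw u hu
    simp [z, hvw.symm, hu]

/-- The neighbours' qubits determine those of `v` in any configuration of nonzero amplitude. Hence a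
single input contributes to the amplitude at `Function.update z v a`, which is a nonzero multiple of
the entry `D v a b`. -/
theorem eq_zero_of_applyLocal_eq_zero {D : ∀ v, NodeOp G v} {v : V} (hD : ∀ u, u ≠ v → D u = 1)
    (h0 : applyLocal D (networkState G) = 0) : D v = 0 := by
  ext a b
  obtain ⟨z, hz, rfl, -⟩ := exists_networkState_ne_zero v v b b
  have hx := congrFun h0 (Function.update z v a)
  rw [applyLocal, Finset.sum_eq_single z, Finset.prod_eq_single v] at hx
  · simpa [networkState_ne_zero hz] using hx
  · intro u _ hu
    rw [hD u hu, Function.update_of_ne hu, Matrix.one_apply_eq]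
  · simp
  · intro y _ hy
    by_cases hyz : ∀ u, u ≠ v → y u = z u
    · have hyv : y v ≠ z v := fun hh => hy (funext fun u => by
        by_cases hu : u = v
        · rw [hu, hh]
        · exact hyz u hu)
      obtain ⟨c, hc⟩ := Function.ne_iff.1 hyv
      have hcv : c.1 ≠ v := fun hh => G.loopless.irrefl v (by have := c.2; rwa [hh] at this)
      have h1 := hz v c.1 c.2
      have : networkState G y = 0 := by
        refine networkState_eq_zero_of_eq (v := v) (w := c.1) c.2 ?_
        rw [hyz c.1 hcv]
        change y v c = _
        change z v c ≠ _ at h1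
        generalize z c.1 _ = t at *
        generalize y v c = r at *
        generalize z v c = q at *
        revert r q t
        decide
      rw [this, mul_zero]
    · push Not at hyz
      obtain ⟨u, hu, hne⟩ := hyz
      rw [Finset.prod_eq_zero (Finset.mem_univ u), zero_mul]
      rw [hD u hu, Function.update_of_ne hu, Matrix.one_apply_ne hne.symm]
  · simp

theorem networkState_ne_zero' : networkState G ≠ 0 := by
  by_cases hV : Nonempty V
  · obtain ⟨v⟩ := hV
    obtain ⟨z, hz, -⟩ := exists_networkState_ne_zero v v (0 : NodeBasis G v) 0
    exact fun h => networkState_ne_zero hz (congrFun h z)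
  · rw [not_nonempty_iff] at hV
    exact fun h => networkState_ne_zero (x := fun v => isEmptyElim v)
      (fun v => isEmptyElim v) (congrFun h _)

/-- The sum over configurations that may differ from `x` on one edge only. -/
theorem sum_eq_sum_setEdge (x : ∀ u, NodeBasis G u) {v w : V} (h : G.Adj v w)
    (f : (∀ u, NodeBasis G u) → ℂ)
    (hf : ∀ y, (∀ u, u ≠ v → u ≠ w → y u = x u) ∧ (∀ c : G.neighborSet v, c.1 ≠ w → y v c = x v c) ∧
      (∀ c : G.neighborSet w, c.1 ≠ v → y w c = x w c) ∨ f y = 0) :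
    ∑ y, f y = ∑ s : Fin 2 × Fin 2, f (setEdge x v w s.1 s.2) := by
  symm
  refine Fintype.sum_of_injective _ (setEdge_injective x h) _ _ (fun y hy => ?_) fun _ => rfl
  refine (hf y).resolve_left fun hh => hy ⟨(y v ⟨w, h⟩, y w ⟨v, h.symm⟩), ?_⟩
  obtain ⟨h1, h2, h3⟩ := hh
  funext a b
  simp only [setEdge]
  split_ifs with c1 c2
  · obtain ⟨rfl, hb⟩ := c1
    congr 1
    exact Subtype.ext hb.symm
  · obtain ⟨rfl, hb⟩ := c2
    congr 1
    exact Subtype.ext hb.symm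
  · by_cases hav : a = v
    · subst hav
      exact (h2 b fun hb => c1 ⟨rfl, hb⟩).symm
    by_cases haw : a = w
    · subst haw
      exact (h3 b fun hb => c2 ⟨rfl, hb⟩).symm
    rw [h1 a hav haw]

/-- This is `A ε Aᵀ = det A • ε` for an antisymmetric 2 × 2 matrix ε; all other qubits are
untouched. -/
theorem applyLocal_edgeOp_single {v w : V} (h : G.Adj v w) (A : Matrix (Fin 2) (Fin 2) ℂ) :
    applyLocal (edgeOp fun e => if e = s(v, w) then A else 1) (networkState G) =
      A.det • networkState G := by
  funext x
  have hne := h.ne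
  rw [applyLocal, sum_eq_sum_setEdge x h]
  · obtain ⟨K, hK⟩ := networkState_setEdge x h
    have hx := hK (x v ⟨w, h⟩) (x w ⟨v, h.symm⟩)
    rw [setEdge_self] at hx
    have hprod : ∀ p q : Fin 2, ∏ u, edgeOp (G := G) (fun e => if e = s(v, w) then A else 1) u (x u)
        (setEdge x v w p q u) = A (x v ⟨w, h⟩) p * A (x w ⟨v, h.symm⟩) q := by
      intro p q
      rw [Fintype.prod_eq_mul v w hne]
      · congr 1
        · rw [edgeOp, qubitTensor_apply, Fintype.prod_eq_single ⟨w, h⟩]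
          · rw [if_pos rfl, setEdge_left x h, Function.update_self]
          · intro c hc
            have : ¬ s(v, c.1) = s(v, w) := fun hh => hc (Subtype.ext (Sym2.congr_right.1 hh))
            rw [if_neg this, setEdge_left x h, Function.update_of_ne hc, Matrix.one_apply_eq]
        · rw [edgeOp, qubitTensor_apply, Fintype.prod_eq_single ⟨v, h.symm⟩]
          · rw [if_pos Sym2.eq_swap, setEdge_right x h, Function.update_self]
          · intro c hc
            have : ¬ s(w, c.1) = s(v, w) := fun hh => hc (Subtype.ext
              (Sym2.congr_right.1 (hh.trans Sym2.eq_swap)))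
            rw [if_neg this, setEdge_right x h, Function.update_of_ne hc, Matrix.one_apply_eq]
      · rintro u ⟨hu, hu'⟩
        rw [edgeOp, qubitTensor_apply]
        refine Finset.prod_eq_one fun c _ => ?_
        have : ¬ s(u, c.1) = s(v, w) := by
          rw [Sym2.eq_iff]
          tauto
        rw [if_neg this, setEdge_of_ne _ _ _ hu hu', Matrix.one_apply_eq]
    simp only [hprod, hK, Pi.smul_apply, smul_eq_mul, hx]
    generalize x v ⟨w, h⟩ = i
    generalize x w ⟨v, h.symm⟩ = j
    rw [Fintype.sum_prod_type, Matrix.det_fin_two]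
    fin_cases i <;> fin_cases j <;> simp [singlet] <;> ring
  · intro y
    by_contra! hcon
    obtain ⟨hy, hf⟩ := hcon
    have hprod := Finset.prod_ne_zero_iff.1 (left_ne_zero_of_mul hf)
    have hq : ∀ (u : V) (c : G.neighborSet u), s(u, c.1) ≠ s(v, w) → y u c = x u c := by
      intro u c hc
      have := Finset.prod_ne_zero_iff.1 (hprod u (Finset.mem_univ u)) c (Finset.mem_univ c)
      simp only [if_neg hc] at this
      by_contra hne
      exact this (Matrix.one_apply_ne (Ne.symm hne))
    obtain ⟨c, hc, hcy⟩ := hy (fun u hu hu' => funext fun c => hq u c (by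
        intro hh
        rw [Sym2.eq_iff] at hh
        tauto))
      (fun c hc => hq v c fun hh => hc (Sym2.congr_right.1 hh))
    exact hcy (hq w c fun hh => hc (Sym2.congr_right.1 (hh.trans Sym2.eq_swap)))

/-- Operators acting in the same way on both qubits of each edge fix the network state. -/
theorem applyLocal_edgeOp (X : Sym2 V → Matrix (Fin 2) (Fin 2) ℂ) (hX : ∀ e, (X e).det ≠ 0) :
    ∃ c : ℂ, c ≠ 0 ∧ applyLocal (edgeOp X) (networkState G) = c • networkState G := by
  classical
  have key : ∀ E : Finset (Sym2 V), ∃ c : ℂ, c ≠ 0 ∧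
      applyLocal (edgeOp fun e => if e ∈ E then X e else 1) (networkState G) =
        c • networkState G := by
    intro E
    induction E using Finset.induction_on with
    | empty =>
      refine ⟨1, one_ne_zero, ?_⟩
      simp only [Finset.notMem_empty, if_false, one_smul]
      have : (edgeOp (fun _ => 1) : ∀ v, NodeOp G v) = fun v => 1 := funext edgeOp_one
      rw [this, applyLocal_one]
    | insert e E he ih =>
      obtain ⟨c, hc, ih⟩ := ih
      by_cases hG : e ∈ G.edgeSet
      · induction e with | _ v w
        have hG : G.Adj v w := hG
        refine ⟨(X s(v, w)).det * c, mul_ne_zero (hX _) hc, ?_⟩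
        rw [mul_comm, ← smul_smul, ← applyLocal_edgeOp_single hG, ← applyLocal_smul, ← ih,
          applyLocal_comp]
        congr 1
        funext u
        rw [edgeOp_mul]
        congr 1
        funext e
        by_cases h1 : e = s(v, w)
        · subst h1
          simp [he]
        · simp [h1]
      · refine ⟨c, hc, ?_⟩
        rw [← ih]
        congr 1
        funext u
        simp only [edgeOp]
        congr 1
        funext b
        have : s(u, b.1) ≠ e := by
          rintro rfl
          exact hG b.2
        simp [this]
  obtain ⟨c, hc, h⟩ := key Finset.univ
  exact ⟨c, hc, by simpa using h⟩

end

/-! ### The stabiliser of the network state. -/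

section

variable {V : Type u} [Fintype V] [LinearOrder V] {G : SimpleGraph V} [DecidableRel G.Adj]

/-- The local operators that reset the two qubits of the edge `{v, w}`. -/
noncomputable def resetOp (v w : V) (p q : Fin 2) (u : V) : NodeOp G u :=
  Matrix.of fun x y =>
    if y = (fun b => if u = v ∧ b.1 = w then p else if u = w ∧ b.1 = v then q else x b)
    then 1 else 0

/-- Evaluation at a reset configuration becomes a local operator, which commutes with everything
acting on other nodes. -/
theorem applyLocal_resetOp (v w : V) (p q : Fin 2) (ψ : PureState (NodeBasis G))
    (x : ∀ u, NodeBasis G u) :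
    applyLocal (resetOp v w p q) ψ x = ψ (setEdge x v w p q) := by
  rw [applyLocal, Finset.sum_eq_single (setEdge x v w p q)]
  · rw [Finset.prod_eq_one, one_mul]
    intro u _
    exact if_pos rfl
  · intro y _ hy
    obtain ⟨u, hu⟩ := Function.ne_iff.1 hy
    rw [Finset.prod_eq_zero (Finset.mem_univ u), zero_mul]
    exact if_neg hu
  · simp

theorem resetOp_of_ne {v w u : V} (p q : Fin 2) (hv : u ≠ v) (hw : u ≠ w) :
    (resetOp v w p q u : NodeOp G u) = 1 := by
  ext x y
  simp [resetOp, hv, hw, Matrix.one_apply, eq_comm]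

/-- Operators on the other nodes keep the singlet of an edge. -/
theorem applyLocal_setEdge {E : ∀ u, NodeOp G u} {v w : V} (h : G.Adj v w) (hv : E v = 1)
    (hw : E w = 1) (x : ∀ u, NodeBasis G u) :
    ∃ K : ℂ, ∀ p q, applyLocal E (networkState G) (setEdge x v w p q) = singlet p q * K := by
  choose K hK using fun x : ∀ u, NodeBasis G u => networkState_setEdge x h
  refine ⟨applyLocal E K x, fun p q => ?_⟩
  refine (applyLocal_resetOp v w p q (applyLocal E (networkState G)) x).symm.trans ?_
  rw [applyLocal_comp]
  have hcomm : (fun u => (resetOp v w p q u : NodeOp G u) * E u) =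
      fun u => E u * resetOp v w p q u := by
    funext u
    by_cases h1 : u = v
    · subst h1
      rw [hv, one_mul, mul_one]
    by_cases h2 : u = w
    · subst h2
      rw [hw, one_mul, mul_one]
    rw [resetOp_of_ne _ _ h1 h2, one_mul, mul_one]
  have hreset : applyLocal (resetOp v w p q) (networkState G) = singlet p q • K := by
    funext y
    rw [applyLocal_resetOp, hK]
    rfl
  rw [hcomm, ← applyLocal_comp, hreset, applyLocal_smul]
  rfl

/-- The operators at the other nodes are moved to the right-hand side as inverses, where they leave
the singlet of the edge intact. The sum is thus `A * singlet * Bᵀ` for a block `A` of `D v` and a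
block `B` of `D w`. -/
theorem sum_blocks_of_stabilizer {D : ∀ v, NodeOp G v} (hD : ∀ v, IsUnit (D v)) {a : ℂ}
    (hstab : applyLocal D (networkState G) = a • networkState G) {v w : V} (h : G.Adj v w)
    (f b : NodeBasis G v) (f' b' : NodeBasis G w) :
    ∃ c : ℂ, ∀ p q, ∑ s : Fin 2 × Fin 2,
      D v (Function.update f ⟨w, h⟩ p) (Function.update b ⟨w, h⟩ s.1) *
        D w (Function.update f' ⟨v, h.symm⟩ q) (Function.update b' ⟨v, h.symm⟩ s.2) *
          singlet s.1 s.2 = c * singlet p q := by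
  have hne := h.ne
  let E : ∀ u, NodeOp G u := fun u => if u = v ∨ u = w then 1 else (D u)⁻¹
  let D' : ∀ u, NodeOp G u := fun u => if u = v ∨ u = w then D u else 1
  have hED : applyLocal D' (networkState G) = a • applyLocal E (networkState G) := by
    rw [← applyLocal_smul, ← hstab, applyLocal_comp]
    congr 1
    funext u
    by_cases hu : u = v ∨ u = w
    · simp only [D', E, if_pos hu, one_mul]
    · simp only [D', E, if_neg hu]
      rw [Matrix.nonsing_inv_mul _ ((Matrix.isUnit_iff_isUnit_det _).1 (hD u))]
  obtain ⟨z, hz, hzv, hzw⟩ := exists_networkState_ne_zero v w b b'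
  have hzw := hzw hne
  obtain ⟨Kz, hKz⟩ := networkState_setEdge z h
  have hKz0 : Kz ≠ 0 := by
    rintro rfl
    have := hKz (z v ⟨w, h⟩) (z w ⟨v, h.symm⟩)
    rw [setEdge_self, mul_zero] at this
    exact networkState_ne_zero hz this
  let x : ∀ u, NodeBasis G u := Function.update (Function.update z v f) w f'
  have hxv : x v = f := by simp [x, hne]
  have hxw : x w = f' := by simp [x]
  have hxu : ∀ u, u ≠ v → u ≠ w → x u = z u := fun u h1 h2 => by simp [x, h1, h2]
  obtain ⟨K, hK⟩ := applyLocal_setEdge (E := E) h (by simp [E]) (by simp [E]) x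
  refine ⟨a * K / Kz, fun p q => ?_⟩
  have h1 := congrFun hED (setEdge x v w p q)
  rw [Pi.smul_apply, hK, applyLocal, sum_eq_sum_setEdge z h] at h1
  · have hprod : ∀ s : Fin 2 × Fin 2,
        (∏ u, D' u (setEdge x v w p q u) (setEdge z v w s.1 s.2 u)) =
        D v (Function.update f ⟨w, h⟩ p) (Function.update b ⟨w, h⟩ s.1) *
        D w (Function.update f' ⟨v, h.symm⟩ q) (Function.update b' ⟨v, h.symm⟩ s.2) := by
      intro s
      rw [Fintype.prod_eq_mul v w hne]
      · rw [setEdge_left _ h, setEdge_left _ h, setEdge_right _ h, setEdge_right _ h, hxv, hxw, hzv]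
        have : Function.update (z w) ⟨v, h.symm⟩ s.2 = Function.update b' ⟨v, h.symm⟩ s.2 := by
          funext u
          by_cases hu : u = ⟨v, h.symm⟩
          · rw [hu, Function.update_self, Function.update_self]
          · rw [Function.update_of_ne hu, Function.update_of_ne hu,
              hzw u fun hh => hu (Subtype.ext hh)]
        rw [this]
        simp [D']
      · rintro u ⟨hu, hu'⟩
        rw [setEdge_of_ne _ _ _ hu hu', setEdge_of_ne _ _ _ hu hu', hxu u hu hu']
        simp [D', hu, hu']
    simp only [hprod, hKz, smul_eq_mul, ← mul_assoc] at h1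
    rw [← Finset.sum_mul] at h1
    field_simp
    rw [h1]
    ring
  · intro y
    by_contra! hcon
    obtain ⟨hy, hf⟩ := hcon
    have hprod := Finset.prod_ne_zero_iff.1 (left_ne_zero_of_mul hf)
    have hΨ := right_ne_zero_of_mul hf
    have hyu : ∀ u, u ≠ v → u ≠ w → y u = z u := by
      intro u hu hu'
      have := hprod u (Finset.mem_univ u)
      rw [setEdge_of_ne _ _ _ hu hu', hxu u hu hu'] at this
      simp only [D', hu, hu', or_self, if_false] at this
      by_contra hne'
      exact this (Matrix.one_apply_ne (Ne.symm hne'))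
    -- A neighbour other than `v` and `w` keeps its qubit, and a nonzero amplitude forces the
    -- partner qubit to be opposite to it; so only the qubits of the edge `{v, w}` are free.
    have hflip : ∀ i j k : Fin 2, i ≠ k → j ≠ k → i = j := by decide
    have hside : ∀ (t : V) (c : G.neighborSet t), c.1 ≠ v → c.1 ≠ w → y t c = z t c := by
      intro t c hcv hcw
      refine hflip _ _ (z c.1 ⟨t, G.adj_symm c.2⟩) ?_ (hz t c.1 c.2)
      rw [← hyu c.1 hcv hcw]
      exact fun hh => hΨ (networkState_eq_zero_of_eq (v := t) (w := c.1) c.2 hh)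
    obtain ⟨c, hc, hcy⟩ := hy hyu fun c hc => hside v c
      (fun hh => G.loopless.irrefl v (by have := c.2; rwa [hh] at this)) hc
    exact hcy (hside w c hc fun hh => G.loopless.irrefl w (by have := c.2; rwa [hh] at this))

/-- Compare with `A * singlet * Aᵀ = A.det • singlet` and cancel `A * singlet`. -/
theorem eq_smul_of_mul_singlet {A B : Matrix (Fin 2) (Fin 2) ℂ} {c : ℂ} (hA : A.det ≠ 0)
    (h : A * singlet * Bᵀ = c • singlet) : ∃ r : ℂ, B = r • A := by
  refine ⟨c / A.det, ?_⟩
  have hs : ((Real.sqrt 2 : ℝ) : ℂ)⁻¹ ≠ 0 := by simp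
  rw [singlet, Matrix.mul_smul, Matrix.smul_mul, smul_comm c] at h
  have h := smul_right_injective _ hs h
  have h00 := congrFun (congrFun h 0) 0
  have h01 := congrFun (congrFun h 0) 1
  have h10 := congrFun (congrFun h 1) 0
  have h11 := congrFun (congrFun h 1) 1
  simp [Matrix.mul_apply, Fin.sum_univ_two] at h00 h01 h10 h11
  rw [Matrix.det_fin_two] at hA ⊢
  ext i j
  rw [Matrix.smul_apply, smul_eq_mul, div_mul_eq_mul_div, eq_div_iff hA]
  fin_cases i <;> fin_cases j <;> simp
  · linear_combination A 1 0 * h00 - A 0 0 * h10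
  · linear_combination A 1 1 * h00 - A 0 1 * h10
  · linear_combination A 1 0 * h01 - A 0 0 * h11
  · linear_combination A 1 1 * h01 - A 0 1 * h11

theorem det_ne_zero_of_mul_singlet {A B : Matrix (Fin 2) (Fin 2) ℂ} {c : ℂ} (hc : c ≠ 0)
    (h : A * singlet * Bᵀ = c • singlet) : A.det ≠ 0 ∧ B.det ≠ 0 := by
  have hs : singlet.det ≠ 0 := by
    rw [Matrix.det_fin_two]
    simp [singlet]
  have h2 := congrArg Matrix.det h
  rw [Matrix.det_mul, Matrix.det_mul, Matrix.det_transpose, Matrix.det_smul] at h2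
  constructor <;> intro h0 <;> rw [h0] at h2 <;> simp [hc, hs] at h2

theorem mul_singlet_swap {A B : Matrix (Fin 2) (Fin 2) ℂ} {c : ℂ}
    (h : A * singlet * Bᵀ = c • singlet) : B * singlet * Aᵀ = c • singlet := by
  have hs : singletᵀ = -singlet := by
    ext i j
    exact (singlet_swap i j).trans rfl
  have h2 := congrArg Matrix.transpose h
  rw [Matrix.transpose_mul, Matrix.transpose_mul, Matrix.transpose_transpose,
    Matrix.transpose_smul, hs, smul_neg, neg_mul, mul_neg, neg_inj, ← mul_assoc] at h2
  exact h2

theorem exists_blocks_of_stabilizer {D : ∀ v, NodeOp G v} (hD : ∀ v, IsUnit (D v)) {a : ℂ}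
    (hstab : applyLocal D (networkState G) = a • networkState G) {v w : V} (h : G.Adj v w) :
    ∃ X : Matrix (Fin 2) (Fin 2) ℂ, X.det ≠ 0 ∧
      (∀ f b : NodeBasis G v, ∃ c : ℂ, ∀ p s,
        D v (Function.update f ⟨w, h⟩ p) (Function.update b ⟨w, h⟩ s) = c * X p s) ∧
      (∀ f b : NodeBasis G w, ∃ c : ℂ, ∀ p s,
        D w (Function.update f ⟨v, h.symm⟩ p) (Function.update b ⟨v, h.symm⟩ s) = c * X p s) := by
  let A : NodeBasis G v → NodeBasis G v → Matrix (Fin 2) (Fin 2) ℂ := fun f b =>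
    Matrix.of fun p s => D v (Function.update f ⟨w, h⟩ p) (Function.update b ⟨w, h⟩ s)
  let B : NodeBasis G w → NodeBasis G w → Matrix (Fin 2) (Fin 2) ℂ := fun f b =>
    Matrix.of fun p s => D w (Function.update f ⟨v, h.symm⟩ p) (Function.update b ⟨v, h.symm⟩ s)
  have hAB : ∀ f b f' b', ∃ c : ℂ, A f b * singlet * (B f' b')ᵀ = c • singlet := by
    intro f b f' b'
    obtain ⟨c, hc⟩ := sum_blocks_of_stabilizer hD hstab h f b f' b'
    refine ⟨c, ?_⟩
    ext p q
    have := hc p q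
    rw [Fintype.sum_prod_type] at this
    rw [Matrix.smul_apply, smul_eq_mul, ← this]
    simp only [Matrix.mul_apply, Matrix.transpose_apply, Fin.sum_univ_two, A, B, Matrix.of_apply]
    ring
  have hDv : D v ≠ 0 := (hD v).ne_zero
  obtain ⟨f₀, b₀, hfb⟩ : ∃ f₀ b₀, D v f₀ b₀ ≠ 0 := by
    by_contra! hcon
    exact hDv (Matrix.ext hcon)
  have hA₀ : A f₀ b₀ (f₀ ⟨w, h⟩) (b₀ ⟨w, h⟩) ≠ 0 := by simpa [A] using hfb
  -- Otherwise a nonzero row of `A f₀ b₀ * singlet`, placed on the qubit of `w` towards `v` with all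
  -- other qubits 0, would be a kernel vector of the invertible `D w`.
  obtain ⟨f₁, b₁, hne⟩ : ∃ f₁ b₁, A f₀ b₀ * singlet * (B f₁ b₁)ᵀ ≠ 0 := by
    by_contra! hcon
    let r : Fin 2 → ℂ := fun t => (A f₀ b₀ * singlet) (f₀ ⟨w, h⟩) t
    let e : Fin 2 → NodeBasis G w := fun t => Function.update 0 ⟨v, h.symm⟩ t
    have he : Function.Injective e := Function.update_injective (0 : NodeBasis G w) ⟨v, h.symm⟩
    let g : NodeBasis G w → ℂ := ∑ t, Pi.single (e t) (r t)
    have hg : D w *ᵥ g = 0 := by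
      funext x
      have h1 := congrFun (congrFun (hcon x 0) (f₀ ⟨w, h⟩)) (x ⟨v, h.symm⟩)
      rw [Matrix.mul_apply] at h1
      simp only [g, Matrix.mulVec_sum, Finset.sum_apply, Matrix.mulVec_single]
      simp only [B, Matrix.transpose_apply, Matrix.of_apply, Function.update_eq_self] at h1
      simpa [e, r, mul_comm] using h1
    have hg0 : g = 0 := by
      have hu := (Matrix.isUnit_iff_isUnit_det _).1 (hD w)
      rw [← Matrix.one_mulVec g, ← Matrix.nonsing_inv_mul _ hu, ← Matrix.mulVec_mulVec, hg,
        Matrix.mulVec_zero]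
    have hr : ∀ t, r t = 0 := by
      intro t
      have := congrFun hg0 (e t)
      simp only [g, Finset.sum_apply] at this
      rw [Finset.sum_eq_single t] at this
      · simpa using this
      · intro t' _ ht'
        exact Pi.single_eq_of_ne (fun hh => ht' (he hh).symm) _
      · simp
    have hr0 := hr 0
    have hr1 := hr 1
    simp [r, Matrix.mul_apply, Fin.sum_univ_two, singlet] at hr0 hr1
    generalize f₀ ⟨w, h⟩ = i at *
    generalize b₀ ⟨w, h⟩ = j at *
    fin_cases j
    · exact hA₀ hr1
    · exact hA₀ hr0
  obtain ⟨c, hc⟩ := hAB f₀ b₀ f₁ b₁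
  have hc0 : c ≠ 0 := by
    rintro rfl
    rw [zero_smul] at hc
    exact hne hc
  obtain ⟨hdA, hdB⟩ := det_ne_zero_of_mul_singlet hc0 hc
  obtain ⟨r₁, hr₁⟩ := eq_smul_of_mul_singlet hdA hc
  refine ⟨A f₀ b₀, hdA, fun f b => ?_, fun f b => ?_⟩
  · obtain ⟨c', hc'⟩ := hAB f b f₁ b₁
    obtain ⟨r, hr⟩ := eq_smul_of_mul_singlet hdB (mul_singlet_swap hc')
    refine ⟨r * r₁, fun p s => ?_⟩
    have := congrFun (congrFun hr p) s
    rw [hr₁, smul_smul] at this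
    exact this
  · obtain ⟨c', hc'⟩ := hAB f₀ b₀ f b
    obtain ⟨r, hr⟩ := eq_smul_of_mul_singlet hdA hc'
    exact ⟨r, fun p s => congrFun (congrFun hr p) s⟩

/-- An operator that is a multiple of `X w` on each qubit `w` is a multiple of `⨂ X w`. -/
theorem eq_smul_qubitTensor_of_blocks {v : V} {D : NodeOp G v} (hD : D ≠ 0)
    {X : G.neighborSet v → Matrix (Fin 2) (Fin 2) ℂ} (hX : ∀ w, (X w).det ≠ 0)
    (h : ∀ w, ∀ f b : NodeBasis G v, ∃ c : ℂ, ∀ p s,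
      D (Function.update f w p) (Function.update b w s) = c * X w p s) :
    ∃ r : ℂ, r ≠ 0 ∧ D = r • qubitTensor X := by
  -- Indices are exchanged one qubit at a time, so that all entries of `D` are compared with one at
  -- which every `X w` is nonzero.
  have key : ∀ (x y p q : NodeBasis G v) (S : Finset (G.neighborSet v)),
      D x y * ∏ w ∈ S, X w (p w) (q w) =
        D (S.piecewise p x) (S.piecewise q y) * ∏ w ∈ S, X w (x w) (y w) := by
    intro x y p q S
    induction S using Finset.induction_on with
    | empty => simp
    | insert w S hw ih =>
      rw [Finset.prod_insert hw, Finset.prod_insert hw, Finset.piecewise_insert,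
        Finset.piecewise_insert]
      obtain ⟨c, hc⟩ := h w (S.piecewise p x) (S.piecewise q y)
      have h1 := hc (x w) (y w)
      have hx : Function.update (S.piecewise p x) w (x w) = S.piecewise p x := by
        rw [Function.update_eq_self_iff, Finset.piecewise_eq_of_notMem _ _ _ hw]
      have hy : Function.update (S.piecewise q y) w (y w) = S.piecewise q y := by
        rw [Function.update_eq_self_iff, Finset.piecewise_eq_of_notMem _ _ _ hw]
      rw [hx, hy] at h1
      rw [hc, mul_left_comm, ih, h1]
      ring
  have hent : ∀ w, ∃ p q, X w p q ≠ 0 := by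
    intro w
    by_contra! hcon
    exact hX w (by rw [Matrix.det_fin_two]; simp [hcon])
  choose p q hpq using hent
  have hP : ∏ w, X w (p w) (q w) ≠ 0 := Finset.prod_ne_zero_iff.2 fun w _ => hpq w
  have hDX : D = (D p q / ∏ w, X w (p w) (q w)) • qubitTensor X := by
    ext x y
    have := key x y p q Finset.univ
    rw [Finset.piecewise_univ, Finset.piecewise_univ] at this
    rw [Matrix.smul_apply, qubitTensor_apply, smul_eq_mul, div_mul_eq_mul_div, eq_div_iff hP, this]
  refine ⟨_, fun h0 => hD ?_, hDX⟩
  rw [hDX, h0, zero_smul]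

/-- A left kernel vector of `D v` gives an operator at `v` alone that annihilates the network state,
hence vanishes. -/
theorem isUnit_of_applyLocal_eq_smul {D : ∀ v, NodeOp G v} {a : ℂ} (ha : a ≠ 0)
    (hstab : applyLocal D (networkState G) = a • networkState G) (v : V) : IsUnit (D v) := by
  rw [Matrix.isUnit_iff_isUnit_det, isUnit_iff_ne_zero]
  intro hdet
  obtain ⟨g, hg, hgD⟩ := Matrix.exists_vecMul_eq_zero_iff.2 hdet
  let L : NodeOp G v := Matrix.of fun _ y => g y
  have hL : L * D v = 0 := by
    ext x y
    exact congrFun hgD y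
  have h0 : applyLocal (Function.update (fun u => (1 : NodeOp G u)) v L) (networkState G) = 0 := by
    have h1 := applyLocal_comp (Function.update (fun u => (1 : NodeOp G u)) v L) D (networkState G)
    rw [hstab, applyLocal_smul] at h1
    have h2 := h1.trans (applyLocal_eq_zero_of_factor (v := v) _ _
      (by rw [Function.update_self, hL]))
    exact (smul_eq_zero.1 h2).resolve_left ha
  have hL0 := eq_zero_of_applyLocal_eq_zero (v := v)
    (fun u hu => by rw [Function.update_of_ne hu]) h0
  rw [Function.update_self] at hL0
  exact hg (funext fun y => congrFun (congrFun hL0 0) y)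

/-- The local operators fixing the network state up to a scalar are products of single-qubit
operators, equal on the two qubits of each edge. -/
theorem exists_edgeOp_of_stabilizer {D : ∀ v, NodeOp G v} {a : ℂ} (ha : a ≠ 0)
    (hstab : applyLocal D (networkState G) = a • networkState G) :
    ∃ (X : Sym2 V → Matrix (Fin 2) (Fin 2) ℂ) (r : V → ℂ), (∀ e, (X e).det ≠ 0) ∧
      (∀ v, r v ≠ 0) ∧ ∀ v, D v = r v • edgeOp X v := by
  have hD := isUnit_of_applyLocal_eq_smul ha hstab
  have hX : ∀ e : Sym2 V, ∃ X : Matrix (Fin 2) (Fin 2) ℂ, X.det ≠ 0 ∧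
      ∀ (v w : V) (h : G.Adj v w), s(v, w) = e → ∀ f b : NodeBasis G v, ∃ c : ℂ, ∀ p s,
        D v (Function.update f ⟨w, h⟩ p) (Function.update b ⟨w, h⟩ s) = c * X p s := by
    intro e
    induction e with | _ v w
    by_cases h : G.Adj v w
    · obtain ⟨X, hX, h1, h2⟩ := exists_blocks_of_stabilizer hD hstab h
      refine ⟨X, hX, fun v' w' h' he => ?_⟩
      rcases Sym2.eq_iff.1 he with ⟨rfl, rfl⟩ | ⟨rfl, rfl⟩
      · exact h1
      · exact h2
    · refine ⟨1, by simp, fun v' w' h' he => (h ?_).elim⟩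
      have : s(v', w') ∈ G.edgeSet := h'
      rwa [he] at this
  choose X hdet hblocks using hX
  have hr : ∀ v, ∃ r : ℂ, r ≠ 0 ∧ D v = r • edgeOp X v := fun v =>
    eq_smul_qubitTensor_of_blocks (hD v).ne_zero (fun w => hdet _) fun w =>
      hblocks s(v, w.1) v w.1 w.2 rfl
  choose r hr0 hr using hr
  exact ⟨X, r, hdet, hr0, hr⟩

end

/-! ### Rigidity of β + a σ_z ⊗ σ_z under conjugation by product operators. -/

open scoped Classical in
/-- For a monomial `Y`, the sign `ε` such that `Y† σ_z Y` is `ε σ_z` times a diagonal matrix. -/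
noncomputable def flipSign (Y : Matrix (Fin 2) (Fin 2) ℂ) : ℂ := if Y 0 0 = 0 then -1 else 1

theorem flipSign_mul_self (Y : Matrix (Fin 2) (Fin 2) ℂ) : flipSign Y * flipSign Y = 1 := by
  unfold flipSign
  split_ifs <;> norm_num

theorem eq_zero_of_conj_comb {Y : Matrix (Fin 2) (Fin 2) ℂ} (hY : Y.det ≠ 0) {x y : ℂ}
    (h : ∀ k l, x * (Yᴴ * Y) k l + y * (Yᴴ * pauliZ * Y) k l = 0) : x = 0 ∧ y = 0 := by
  have hu : IsUnit Y.det := isUnit_iff_ne_zero.2 hY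
  have hu' : IsUnit Yᴴ.det := by
    rw [Matrix.det_conjTranspose]
    exact hu.star
  have hM : Yᴴ * (x • (1 : Matrix (Fin 2) (Fin 2) ℂ) + y • pauliZ) * Y = 0 := by
    ext k l
    simp only [mul_add, add_mul, Matrix.mul_smul, Matrix.smul_mul, mul_one]
    simpa using h k l
  have hM' : x • (1 : Matrix (Fin 2) (Fin 2) ℂ) + y • pauliZ = 0 := by
    have := congrArg (fun M => Yᴴ⁻¹ * M * Y⁻¹) hM
    simp only [Matrix.mul_zero, Matrix.zero_mul] at this
    rwa [mul_assoc Yᴴ, ← mul_assoc Yᴴ⁻¹, Matrix.nonsing_inv_mul _ hu', one_mul, mul_assoc,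
      Matrix.mul_nonsing_inv _ hu, mul_one] at this
  have h0 := congrFun (congrFun hM' 0) 0
  have h1 := congrFun (congrFun hM' 1) 1
  simp [pauliZ] at h0 h1
  constructor
  · linear_combination (h0 + h1) / 2
  · linear_combination (h0 - h1) / 2

/-- Half the sum and half the difference of the hypotheses say that each row of `Y` has a zero
entry; being invertible, `Y` is diagonal or antidiagonal. -/
theorem monomial_of_conj_offdiag {Y : Matrix (Fin 2) (Fin 2) ℂ} (hY : Y.det ≠ 0)
    (hP : (Yᴴ * Y) 0 1 = 0) (hQ : (Yᴴ * pauliZ * Y) 0 1 = 0) :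
    ∃ p₀ p₁ : ℂ, p₀ ≠ 0 ∧ p₁ ≠ 0 ∧ Yᴴ * Y = !![p₀, 0; 0, p₁] ∧
      Yᴴ * pauliZ * Y = flipSign Y • !![p₀, 0; 0, -p₁] := by
  rw [Matrix.det_fin_two] at hY
  simp [Matrix.mul_apply, Fin.sum_univ_two, pauliZ] at hP hQ
  have h1 : (starRingEnd ℂ) (Y 0 0) * Y 0 1 = 0 := by linear_combination (hP + hQ) / 2
  have h2 : (starRingEnd ℂ) (Y 1 0) * Y 1 1 = 0 := by linear_combination (hP - hQ) / 2
  simp only [mul_eq_zero, map_eq_zero] at h1 h2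
  by_cases h00 : Y 0 0 = 0
  · have h01 : Y 0 1 ≠ 0 := fun h => hY (by rw [h00, h]; ring)
    have h10 : Y 1 0 ≠ 0 := fun h => hY (by rw [h00, h]; ring)
    have h11 : Y 1 1 = 0 := h2.resolve_left h10
    refine ⟨starRingEnd ℂ (Y 1 0) * Y 1 0, starRingEnd ℂ (Y 0 1) * Y 0 1,
      by simp [h10], by simp [h01], ?_, ?_⟩
    · ext i j
      fin_cases i <;> fin_cases j <;> simp [Matrix.mul_apply, Fin.sum_univ_two, h00, h11]
    · ext i j
      fin_cases i <;> fin_cases j <;>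
        simp [Matrix.mul_apply, Fin.sum_univ_two, h00, h11, pauliZ, flipSign]
  · have h01 : Y 0 1 = 0 := h1.resolve_left h00
    have h11 : Y 1 1 ≠ 0 := fun h => hY (by rw [h01, h]; ring)
    have h10 : Y 1 0 = 0 := h2.resolve_right h11
    refine ⟨starRingEnd ℂ (Y 0 0) * Y 0 0, starRingEnd ℂ (Y 1 1) * Y 1 1,
      by simp [h00], by simp [h11], ?_, ?_⟩
    · ext i j
      fin_cases i <;> fin_cases j <;> simp [Matrix.mul_apply, Fin.sum_univ_two, h01, h10]
    · ext i j
      fin_cases i <;> fin_cases j <;>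
        simp [Matrix.mul_apply, Fin.sum_univ_two, h00, h01, h10, pauliZ, flipSign]

/-- The operators `Y₁ ⊗ Y₂` that fix `β + a σ_z ⊗ σ_z` up to a scalar. -/
theorem two_qubit_rigidity {Y₁ Y₂ : Matrix (Fin 2) (Fin 2) ℂ} (h₁ : Y₁.det ≠ 0) (h₂ : Y₂.det ≠ 0)
    {β a : ℝ} {r : ℂ} (hr : r ≠ 0) (hβ : β ≠ 0) (ha : a ≠ 0) (hp : β + a ≠ 0) (hm : β - a ≠ 0)
    (h : ∀ i j k l, (β : ℂ) * ((Y₁ᴴ * Y₁) i j * (Y₂ᴴ * Y₂) k l) +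
      a * ((Y₁ᴴ * pauliZ * Y₁) i j * (Y₂ᴴ * pauliZ * Y₂) k l) =
      r * (β * ((1 : Matrix (Fin 2) (Fin 2) ℂ) i j * (1 : Matrix (Fin 2) (Fin 2) ℂ) k l) +
        a * (pauliZ i j * pauliZ k l))) :
    (∃ ρ : ℂ, Y₁ᴴ * Y₁ = ρ • 1 ∧ Y₁ᴴ * pauliZ * Y₁ = (ρ * flipSign Y₁) • pauliZ) ∧
    (∃ ρ : ℂ, Y₂ᴴ * Y₂ = ρ • 1 ∧ Y₂ᴴ * pauliZ * Y₂ = (ρ * flipSign Y₂) • pauliZ) ∧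
    flipSign Y₁ * flipSign Y₂ = 1 := by
  have hβ' : (β : ℂ) ≠ 0 := by exact_mod_cast hβ
  have ha' : (a : ℂ) ≠ 0 := by exact_mod_cast ha
  have hp' : (β : ℂ) + a ≠ 0 := by exact_mod_cast hp
  have hm' : (β : ℂ) - a ≠ 0 := by exact_mod_cast hm
  -- The right-hand side of `h` is diagonal, so an off-diagonal entry in one factor yields a
  -- vanishing combination in the other.
  have e₁ := eq_zero_of_conj_comb (x := β * (Y₁ᴴ * Y₁) 0 1) (y := a * (Y₁ᴴ * pauliZ * Y₁) 0 1) h₂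
    fun k l => by
      have := h 0 1 k l
      simp only [pauliZ, Matrix.one_apply] at this ⊢
      simp at this ⊢
      linear_combination this
  have e₂ := eq_zero_of_conj_comb (x := β * (Y₂ᴴ * Y₂) 0 1) (y := a * (Y₂ᴴ * pauliZ * Y₂) 0 1) h₁
    fun k l => by
      have := h k l 0 1
      simp only [pauliZ, Matrix.one_apply] at this ⊢
      simp at this ⊢
      linear_combination this
  obtain ⟨p₀, p₁, hp₀, hp₁, hP₁, hQ₁⟩ := monomial_of_conj_offdiag h₁
    ((mul_eq_zero.1 e₁.1).resolve_left hβ') ((mul_eq_zero.1 e₁.2).resolve_left ha')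
  obtain ⟨q₀, q₁, hq₀, hq₁, hP₂, hQ₂⟩ := monomial_of_conj_offdiag h₂
    ((mul_eq_zero.1 e₂.1).resolve_left hβ') ((mul_eq_zero.1 e₂.2).resolve_left ha')
  rw [hP₁, hP₂, hQ₁, hQ₂] at h
  have h00 := h 0 0 0 0
  have h01 := h 0 0 1 1
  have h10 := h 1 1 0 0
  have h11 := h 1 1 1 1
  simp [pauliZ] at h00 h01 h10 h11
  have hη : flipSign Y₁ * flipSign Y₂ = 1 := by
    have hsq : (flipSign Y₁ * flipSign Y₂) * (flipSign Y₁ * flipSign Y₂) = 1 := by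
      linear_combination (flipSign Y₂ * flipSign Y₂) * flipSign_mul_self Y₁ + flipSign_mul_self Y₂
    -- With sign -1, computing `p₀ * p₁ * q₀ * q₁` in two ways gives (β + a)⁴ = (β - a)⁴. The
    -- difference is 8βa(β² + a²), which is nonzero for real nonzero β and a.
    refine (mul_self_eq_one_iff.1 hsq).resolve_right fun hneg => ?_
    have g00 : p₀ * q₀ * (β - a) = r * (β + a) := by
      linear_combination h00 - a * (p₀ * q₀) * hneg
    have g01 : p₀ * q₁ * (β + a) = r * (β - a) := by
      linear_combination h01 + a * (p₀ * q₁) * hneg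
    have g10 : p₁ * q₀ * (β + a) = r * (β - a) := by
      linear_combination h10 + a * (p₁ * q₀) * hneg
    have g11 : p₁ * q₁ * (β - a) = r * (β + a) := by
      linear_combination h11 - a * (p₁ * q₁) * hneg
    have key : r ^ 2 * (((β + a) ^ 4 - (β - a) ^ 4 : ℝ) : ℂ) = 0 := by
      push_cast
      linear_combination -(β + a) ^ 2 * (r * (β + a) * g00 + p₀ * q₀ * (β - a) * g11) +
        (β - a) ^ 2 * (r * (β - a) * g01 + p₀ * q₁ * (β + a) * g10)
    rcases mul_eq_zero.1 key with h0 | h0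
    · exact hr (pow_eq_zero_iff two_ne_zero |>.1 h0)
    · have h0 : (β + a) ^ 4 - (β - a) ^ 4 = 0 := by exact_mod_cast h0
      have h0 : (β * a) * (β ^ 2 + a ^ 2) = 0 := by linear_combination h0 / 8
      rcases mul_eq_zero.1 h0 with h0 | h0
      · exact mul_ne_zero hβ ha h0
      · have := pow_pos (abs_pos.2 hβ) 2
        rw [sq_abs] at this
        nlinarith [sq_nonneg a]
  have g00 : p₀ * q₀ = r := mul_right_cancel₀ hp' (by
    linear_combination h00 - a * (p₀ * q₀) * hη)
  have g01 : p₀ * q₁ = r := mul_right_cancel₀ hm' (by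
    linear_combination h01 + a * (p₀ * q₁) * hη)
  have g10 : p₁ * q₀ = r := mul_right_cancel₀ hm' (by
    linear_combination h10 + a * (p₁ * q₀) * hη)
  have hpp : p₁ = p₀ := mul_right_cancel₀ hq₀ (g10.trans g00.symm)
  have hqq : q₁ = q₀ := mul_left_cancel₀ hp₀ (g01.trans g00.symm)
  subst hpp hqq
  refine ⟨⟨p₁, ?_, ?_⟩, ⟨q₁, ?_, ?_⟩, hη⟩
  · rw [hP₁]
    ext i j
    fin_cases i <;> fin_cases j <;> simp
  · rw [hQ₁]
    ext i j
    fin_cases i <;> fin_cases j <;> simp [pauliZ, mul_comm]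
  · rw [hP₂]
    ext i j
    fin_cases i <;> fin_cases j <;> simp
  · rw [hQ₂]
    ext i j
    fin_cases i <;> fin_cases j <;> simp [pauliZ, mul_comm]

theorem prod_update_one {N : Type*} [Fintype N] [DecidableEq N]
    (F : N → Matrix (Fin 2) (Fin 2) ℂ) (u : N) (i j : Fin 2) :
    ∏ w, F w (Function.update (0 : N → Fin 2) u i w) (Function.update (0 : N → Fin 2) u j w) =
      F u i j * ∏ w ∈ Finset.univ.erase u, F w 0 0 := by
  rw [← Finset.mul_prod_erase _ _ (Finset.mem_univ u), Function.update_self, Function.update_self]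
  congr 1
  refine Finset.prod_congr rfl fun w hw => ?_
  have := (Finset.mem_erase.1 hw).1
  simp [this]

theorem prod_update_two {N : Type*} [Fintype N] [DecidableEq N]
    (F : N → Matrix (Fin 2) (Fin 2) ℂ) {u u' : N} (hu : u ≠ u') (i j k l : Fin 2) :
    ∏ w, F w (Function.update (Function.update (0 : N → Fin 2) u i) u' k w)
        (Function.update (Function.update (0 : N → Fin 2) u j) u' l w) =
      F u i j * F u' k l * ∏ w ∈ (Finset.univ.erase u').erase u, F w 0 0 := by
  rw [← Finset.mul_prod_erase _ _ (Finset.mem_univ u'),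
    ← Finset.mul_prod_erase _ _ (Finset.mem_erase.2 ⟨hu, Finset.mem_univ u⟩)]
  simp only [Function.update_self, Function.update_of_ne hu]
  rw [← mul_assoc, mul_comm (F u' k l)]
  congr 1
  refine Finset.prod_congr rfl fun w hw => ?_
  obtain ⟨h1, h2⟩ := Finset.mem_erase.1 hw
  have h2 := (Finset.mem_erase.1 h2).1
  simp [h1, h2]

section

variable {V : Type u} [Fintype V] [LinearOrder V] {G : SimpleGraph V} [DecidableRel G.Adj] {v : V}

/-- `β + a ⨂ σ_z` with one factor for each qubit in `C`. -/
noncomputable def zzOp (C : G.neighborSet v → Prop) [DecidablePred C] (β a : ℝ) : NodeOp G v :=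
  (β : ℂ) • (1 : NodeOp G v) + (a : ℂ) • qubitTensor fun w => if C w then pauliZ else 1

theorem zzOp_apply (C : G.neighborSet v → Prop) [DecidablePred C] (β a : ℝ)
    (x y : NodeBasis G v) : zzOp C β a x y =
      β * ∏ w, (1 : Matrix (Fin 2) (Fin 2) ℂ) (x w) (y w) +
        a * ∏ w, (if C w then pauliZ else 1 : Matrix (Fin 2) (Fin 2) ℂ) (x w) (y w) := by
  rw [zzOp, ← qubitTensor_one]
  rfl

theorem conj_zzOp (C : G.neighborSet v → Prop) [DecidablePred C] (β a : ℝ)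
    (Y : G.neighborSet v → Matrix (Fin 2) (Fin 2) ℂ) :
    (qubitTensor Y)ᴴ * zzOp C β a * qubitTensor Y =
      (β : ℂ) • (qubitTensor fun w => (Y w)ᴴ * Y w) +
      (a : ℂ) • qubitTensor fun w => (Y w)ᴴ * (if C w then pauliZ else 1) * Y w := by
  rw [zzOp, qubitTensor_conjTranspose, mul_add, add_mul, Matrix.mul_smul, Matrix.smul_mul, mul_one,
    Matrix.mul_smul, Matrix.smul_mul, qubitTensor_mul, qubitTensor_mul, qubitTensor_mul]

theorem conj_zzOp_apply (C : G.neighborSet v → Prop) [DecidablePred C] (β a : ℝ)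
    (Y : G.neighborSet v → Matrix (Fin 2) (Fin 2) ℂ) (x y : NodeBasis G v) :
    ((qubitTensor Y)ᴴ * zzOp C β a * qubitTensor Y) x y =
      β * ∏ w, ((Y w)ᴴ * Y w) (x w) (y w) +
      a * ∏ w, ((Y w)ᴴ * (if C w then pauliZ else 1) * Y w) (x w) (y w) := by
  rw [conj_zzOp]
  rfl

/-- The qubits of `v` in `C` and the coefficients are as at a node of a cycle, or as at another
node. -/
def CycleType (C : G.neighborSet v → Prop) (β a : ℝ) : Prop :=
  β + a ≠ 0 ∧ ((∀ w, ¬ C w) ∨ (β ≠ 0 ∧ a ≠ 0 ∧ β - a ≠ 0 ∧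
    ∃ u u' : G.neighborSet v, u ≠ u' ∧ ∀ w, C w ↔ w = u ∨ w = u'))

/-- A qubit outside `C` enters both terms through the same factor Y†Y, which must therefore be
scalar. Entries with all remaining qubits 0 reduce the two qubits in `C` to `two_qubit_rigidity`. -/
theorem rigidity_of_conj_zzOp {C : G.neighborSet v → Prop} [DecidablePred C] {β a : ℝ}
    (hC : CycleType C β a) {Y : G.neighborSet v → Matrix (Fin 2) (Fin 2) ℂ}
    (hY : ∀ w, (Y w).det ≠ 0) {r : ℂ} (hr : r ≠ 0)
    (h : (qubitTensor Y)ᴴ * zzOp C β a * qubitTensor Y = r • zzOp C β a) :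
    (∀ w, ∃ ρ : ℂ, (Y w)ᴴ * Y w = ρ • 1 ∧
      (C w → (Y w)ᴴ * pauliZ * Y w = (ρ * flipSign (Y w)) • pauliZ)) ∧
    ∏ w, (if C w then flipSign (Y w) else 1) = 1 := by
  obtain ⟨hβa, hC⟩ := hC
  have hβa' : (β : ℂ) + a ≠ 0 := by exact_mod_cast hβa
  have hZ0 : ∀ w, (if C w then pauliZ else 1 : Matrix (Fin 2) (Fin 2) ℂ) 0 0 = 1 := by
    intro w
    split_ifs <;> simp [pauliZ]
  have hent : ∀ x y : NodeBasis G v, _ := fun x y => (conj_zzOp_apply C β a Y x y).symm.trans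
    ((congrFun (congrFun h x) y).trans
      ((Matrix.smul_apply r _ x y).trans (congrArg (r • ·) (zzOp_apply C β a x y))))
  have hout : ∀ w, ¬ C w → ∃ ρ : ℂ, (Y w)ᴴ * Y w = ρ • 1 := by
    intro u hu
    have hh := fun i j => hent (Function.update 0 u i) (Function.update 0 u j)
    simp only [prod_update_one (fun w => (Y w)ᴴ * Y w),
      prod_update_one (fun w => (Y w)ᴴ * (if C w then pauliZ else 1) * Y w),
      prod_update_one (fun _ : G.neighborSet v => (1 : Matrix (Fin 2) (Fin 2) ℂ)),
      prod_update_one (fun w => (if C w then pauliZ else 1 : Matrix (Fin 2) (Fin 2) ℂ)),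
      if_neg hu, mul_one, hZ0, Finset.prod_const_one, Matrix.one_apply_eq, smul_eq_mul] at hh
    set R₁ := ∏ w ∈ Finset.univ.erase u, ((Y w)ᴴ * Y w) 0 0
    set R₂ := ∏ w ∈ Finset.univ.erase u, ((Y w)ᴴ * (if C w then pauliZ else 1) * Y w) 0 0
    have hF : β * R₁ + a * R₂ ≠ 0 := by
      intro h0
      have := hh 0 0
      rw [Matrix.one_apply_eq, mul_one, mul_one] at this
      exact mul_ne_zero hr hβa' (by linear_combination (((Y u)ᴴ * Y u) 0 0) * h0 - this)
    refine ⟨r * (β + a) / (β * R₁ + a * R₂), ?_⟩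
    ext i j
    rw [Matrix.smul_apply, smul_eq_mul, div_mul_eq_mul_div, eq_div_iff hF]
    linear_combination hh i j
  rcases hC with hC | ⟨hβ, ha, hm, u, u', huu, hC⟩
  · refine ⟨fun w => ?_, ?_⟩
    · obtain ⟨ρ, hρ⟩ := hout w (hC w)
      exact ⟨ρ, hρ, fun hw => (hC w hw).elim⟩
    · exact Finset.prod_eq_one fun w _ => if_neg (hC w)
  · have hCu : C u := (hC u).2 (Or.inl rfl)
    have hCu' : C u' := (hC u').2 (Or.inr rfl)
    have hh := fun i j k l => hent (Function.update (Function.update 0 u i) u' k)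
      (Function.update (Function.update 0 u j) u' l)
    simp only [prod_update_two (fun w => (Y w)ᴴ * Y w) huu,
      prod_update_two (fun w => (Y w)ᴴ * (if C w then pauliZ else 1) * Y w) huu,
      prod_update_two (fun _ : G.neighborSet v => (1 : Matrix (Fin 2) (Fin 2) ℂ)) huu,
      prod_update_two (fun w => (if C w then pauliZ else 1 : Matrix (Fin 2) (Fin 2) ℂ)) huu,
      if_pos hCu, if_pos hCu', hZ0, Finset.prod_const_one, mul_one, Matrix.one_apply_eq,
      smul_eq_mul] at hh
    have hR : ∏ w ∈ (Finset.univ.erase u').erase u,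
          ((Y w)ᴴ * (if C w then pauliZ else 1) * Y w) 0 0 =
        ∏ w ∈ (Finset.univ.erase u').erase u, ((Y w)ᴴ * Y w) 0 0 := by
      refine Finset.prod_congr rfl fun w hw => ?_
      obtain ⟨h1, h2⟩ := Finset.mem_erase.1 hw
      have h2 := (Finset.mem_erase.1 h2).1
      have : ¬ C w := fun hw => ((hC w).1 hw).elim h1 h2
      rw [if_neg this, mul_one]
    rw [hR] at hh
    set R := ∏ w ∈ (Finset.univ.erase u').erase u, ((Y w)ᴴ * Y w) 0 0
    have hR0 : R ≠ 0 := by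
      intro h0
      have := hh 0 0 0 0
      rw [h0, Matrix.one_apply_eq] at this
      simp [pauliZ] at this
      exact this.elim hr hβa'
    obtain ⟨⟨ρ, hρ, hρ'⟩, ⟨σ, hσ, hσ'⟩, hsign⟩ := two_qubit_rigidity (hY u) (hY u')
      (div_ne_zero hr hR0) hβ ha hβa hm fun i j k l => by
        rw [div_mul_eq_mul_div, eq_div_iff hR0, ← hh]
        ring
    refine ⟨fun w => ?_, ?_⟩
    · by_cases hw : C w
      · rcases (hC w).1 hw with rfl | rfl
        · exact ⟨ρ, hρ, fun _ => hρ'⟩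
        · exact ⟨σ, hσ, fun _ => hσ'⟩
      · obtain ⟨τ, hτ⟩ := hout w hw
        exact ⟨τ, hτ, fun h => (hw h).elim⟩
    · rw [Fintype.prod_eq_mul u u' huu, if_pos hCu, if_pos hCu', hsign]
      rintro w ⟨h1, h2⟩
      exact if_neg fun hw => ((hC w).1 hw).elim h1 h2

theorem conj_zzOp_eq_smul {C : G.neighborSet v → Prop} [DecidablePred C] {β a : ℝ}
    {Y : G.neighborSet v → Matrix (Fin 2) (Fin 2) ℂ}
    (h : ∀ w, ∃ ρ : ℂ, (Y w)ᴴ * Y w = ρ • 1 ∧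
      (C w → (Y w)ᴴ * pauliZ * Y w = (ρ * flipSign (Y w)) • pauliZ))
    (hsign : ∏ w, (if C w then flipSign (Y w) else 1) = 1) :
    ∃ r : ℂ, (qubitTensor Y)ᴴ * zzOp C β a * qubitTensor Y = r • zzOp C β a := by
  choose ρ hρ hρ' using h
  refine ⟨∏ w, ρ w, ?_⟩
  have h2 : ∀ w, (Y w)ᴴ * (if C w then pauliZ else 1) * Y w =
      (ρ w * if C w then flipSign (Y w) else 1) • if C w then pauliZ else 1 := by
    intro w
    split_ifs with hw
    · exact hρ' w hw
    · rw [mul_one, mul_one, hρ]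
  simp only [conj_zzOp, hρ, h2]
  rw [qubitTensor_smul, qubitTensor_smul, Finset.prod_mul_distrib, hsign, mul_one, qubitTensor_one,
    zzOp, smul_add, smul_comm, smul_comm (a : ℂ)]

/-- Equality would make `zzOp C β a` proportional to a product operator. The diagonal of a product
satisfies f₀₀f₁₁ = f₀₁f₁₀ on two qubits, here (β + a)² = (β - a)², that is 4βa = 0. -/
theorem conj_zzOp_ne_one {C : G.neighborSet v → Prop} [DecidablePred C] {β a : ℝ}
    (hC : CycleType C β a) {u : G.neighborSet v} (hu : C u)
    {Y : G.neighborSet v → Matrix (Fin 2) (Fin 2) ℂ} (hY : ∀ w, (Y w).det ≠ 0) (r : ℂ) :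
    r • ((qubitTensor Y)ᴴ * zzOp C β a * qubitTensor Y) ≠ 1 := by
  intro h
  obtain ⟨-, hC⟩ := hC
  obtain ⟨hβ, ha, -, u, u', huu, hC⟩ := hC.resolve_left fun hn => hn u hu
  have hCu : C u := (hC u).2 (Or.inl rfl)
  have hCu' : C u' := (hC u').2 (Or.inr rfl)
  have hZ0 : ∀ w, (if C w then pauliZ else 1 : Matrix (Fin 2) (Fin 2) ℂ) 0 0 = 1 := by
    intro w
    split_ifs <;> simp [pauliZ]
  have hinv := qubitTensor_mul_inv hY
  have hr : r • zzOp C β a = qubitTensor fun w => ((Y w)⁻¹)ᴴ * (Y w)⁻¹ := by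
    have h1 := congrArg (fun M => (qubitTensor fun w => (Y w)⁻¹)ᴴ * M *
      qubitTensor fun w => (Y w)⁻¹) h
    have h2 : (qubitTensor fun w => (Y w)⁻¹)ᴴ * (qubitTensor Y)ᴴ = 1 := by
      rw [← Matrix.conjTranspose_mul, hinv, Matrix.conjTranspose_one]
    simp only [mul_one, Matrix.mul_smul, Matrix.smul_mul] at h1
    rw [← mul_assoc, ← mul_assoc, h2, one_mul, mul_assoc, hinv, mul_one,
      qubitTensor_conjTranspose, qubitTensor_mul] at h1
    exact h1
  have hent : ∀ x y : NodeBasis G v, _ := fun x y => (congrArg (r • ·) (zzOp_apply C β a x y)).symm.trans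
    (congrFun (congrFun hr x) y)
  have hh := fun i k => hent (Function.update (Function.update 0 u i) u' k)
      (Function.update (Function.update 0 u i) u' k)
  simp only [qubitTensor_apply, prod_update_two (fun w => ((Y w)⁻¹)ᴴ * (Y w)⁻¹) huu,
      prod_update_two (fun w => (if C w then pauliZ else 1 : Matrix (Fin 2) (Fin 2) ℂ)) huu,
      if_pos hCu, if_pos hCu', hZ0, Finset.prod_const_one, mul_one, Matrix.one_apply_eq,
      smul_eq_mul] at hh
  have h00 := hh 0 0
  have h01 := hh 0 1
  have h10 := hh 1 0
  have h11 := hh 1 1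
  simp only [pauliZ, Matrix.of_apply, Matrix.cons_val', Matrix.cons_val_zero, Matrix.cons_val_one,
    Matrix.cons_val_fin_one] at h00 h01 h10 h11
  have key : r ^ 2 * ((β : ℂ) * a) = 0 := by
    linear_combination ((r * (β + a) * h11 + h00 * ((((Y u)⁻¹)ᴴ * (Y u)⁻¹) 1 1 *
      (((Y u')⁻¹)ᴴ * (Y u')⁻¹) 1 1 * ∏ w ∈ (Finset.univ.erase u').erase u,
        (((Y w)⁻¹)ᴴ * (Y w)⁻¹) 0 0)) - (r * (β - a) * h10 + h01 * ((((Y u)⁻¹)ᴴ * (Y u)⁻¹) 1 1 *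
      (((Y u')⁻¹)ᴴ * (Y u')⁻¹) 0 0 * ∏ w ∈ (Finset.univ.erase u').erase u,
        (((Y w)⁻¹)ᴴ * (Y w)⁻¹) 0 0))) / 4
  have hr0 : r ≠ 0 := by
    rintro rfl
    rw [zero_smul] at h
    exact zero_ne_one h
  have hβ' : (β : ℂ) ≠ 0 := by exact_mod_cast hβ
  have ha' : (a : ℂ) ≠ 0 := by exact_mod_cast ha
  exact mul_ne_zero (pow_ne_zero 2 hr0) (mul_ne_zero hβ' ha') key

end

/-! ### Backward induction through a protocol; the obstruction from a cycle. -/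

section

variable {V : Type u} [Fintype V] [DecidableEq V]

theorem applyLocal_update_sum {ι κ : V → Type u} [∀ v, Fintype (ι v)]
    (B : ∀ v, Matrix (κ v) (ι v) ℂ) (v : V) {m : ℕ} (C : Fin m → Matrix (κ v) (ι v) ℂ)
    (ψ : PureState ι) : applyLocal (Function.update B v (∑ k, C k)) ψ =
      ∑ k, applyLocal (Function.update B v (C k)) ψ := by
  have h : ∀ (D : Matrix (κ v) (ι v) ℂ) (x : ∀ v, κ v) (y : ∀ v, ι v),
      ∏ u, Function.update B v D u (x u) (y u) =
        D (x v) (y v) * ∏ u ∈ Finset.univ.erase v, B u (x u) (y u) := by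
    intro D x y
    rw [← Finset.mul_prod_erase _ _ (Finset.mem_univ v), Function.update_self]
    congr 1
    refine Finset.prod_congr rfl fun u hu => ?_
    rw [Function.update_of_ne (Finset.mem_erase.1 hu).1]
  funext x
  simp only [applyLocal, h, Finset.sum_apply, Matrix.sum_apply, Finset.sum_mul]
  exact Finset.sum_comm

/-- By completeness and the isometry conditions, ψ is the sum over the outcomes of M_k†M_k ψ. -/
theorem eq_zero_of_branches_eq_zero {ι : V → Type u} [∀ v, Fintype (ι v)] {ψ : PureState ι}
    {v : V} {m : ℕ} {κ : Fin m → V → Type u} [∀ k w, Fintype (κ k w)]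
    {M : ∀ (k : Fin m) (w : V), Matrix (κ k w) (ι w) ℂ}
    (hmeas : IsMeasurement (fun k => M k v)) (hiso : ∀ k w, w ≠ v → IsIsometry (M k w))
    (h0 : ∀ k, applyLocal (M k) ψ = 0) : ψ = 0 := by
  classical
  have h1 := applyLocal_update_sum (fun w => (1 : Matrix (ι w) (ι w) ℂ)) v
    (fun k => (M k v)ᴴ * M k v) ψ
  have hone : Function.update (fun w => (1 : Matrix (ι w) (ι w) ℂ)) v (∑ k, (M k v)ᴴ * M k v) =
      fun w => 1 := by
    have : ∑ k, (M k v)ᴴ * M k v = 1 := by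
      unfold IsMeasurement at hmeas
      convert hmeas
    rw [this]
    exact Function.update_eq_self v (fun w => (1 : Matrix (ι w) (ι w) ℂ))
  rw [hone, applyLocal_one] at h1
  rw [h1]
  refine Finset.sum_eq_zero fun k _ => ?_
  have h2 : Function.update (fun w => (1 : Matrix (ι w) (ι w) ℂ)) v ((M k v)ᴴ * M k v) =
      fun w => (M k w)ᴴ * M k w := by
    funext w
    by_cases hw : w = v
    · subst hw
      rw [Function.update_self]
    · rw [Function.update_of_ne hw]
      have := hiso k w hw
      unfold IsIsometry at this
      rw [this]
  rw [h2, ← applyLocal_comp (fun w => (M k w)ᴴ), h0, applyLocal_zero]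

end

section

variable {V : Type u} [Fintype V] [LinearOrder V] {G : SimpleGraph V} [DecidableRel G.Adj]

/-- Each edge is counted once from either end. -/
theorem prod_darts_eq_one (F : Sym2 V → ℂ) (hF : ∀ e, F e * F e = 1) :
    ∏ v, ∏ w : G.neighborSet v, F s(v, w.1) = 1 := by
  rw [Finset.prod_sigma']
  refine Finset.prod_involution (fun d _ => ⟨d.2.1, ⟨d.1, G.adj_symm d.2.2⟩⟩) ?_ ?_ ?_ ?_
  · intro d _
    change F s(d.1, d.2.1) * F s(d.2.1, d.1) = 1
    rw [Sym2.eq_swap, hF]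
  · intro d _ _ hd
    have h1 : d.2.1 = d.1 := congrArg Sigma.fst hd
    have h2 := d.2.2
    rw [h1] at h2
    exact G.loopless.irrefl _ h2
  · intro d _
    simp
  · intro d _
    rfl

variable (E : Sym2 V → Prop) [DecidablePred E] (β a : V → ℝ)

/-- The operator `β + a ⨂ σ_z` at each node, with one factor for each edge in `E`. -/
noncomputable def edgeZZOp (v : V) : NodeOp G v := zzOp (fun w => E s(v, w.1)) (β v) (a v)

variable {E β a}

/-- Every edge at `v` has its other end elsewhere, where rigidity applies to the same matrix `Y e`.
The signs multiply to 1 over all nodes and at each `w ≠ v`, hence also at `v`. -/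
theorem conj_edgeZZOp_eq_smul_of_forall_ne
    (hE : ∀ v, CycleType (fun w : G.neighborSet v => E s(v, w.1)) (β v) (a v))
    {Y : Sym2 V → Matrix (Fin 2) (Fin 2) ℂ} (hY : ∀ e, (Y e).det ≠ 0) {v : V} {r : V → ℂ}
    (hr : ∀ w, w ≠ v → r w ≠ 0)
    (h : ∀ w, w ≠ v → ((edgeOp Y w)ᴴ * edgeZZOp E β a w * edgeOp Y w : NodeOp G w) =
      r w • edgeZZOp E β a w) :
    ∃ ρ : ℂ, ((edgeOp Y v)ᴴ * edgeZZOp E β a v * edgeOp Y v : NodeOp G v) =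
      ρ • edgeZZOp E β a v := by
  have hloc := fun w hw => rigidity_of_conj_zzOp (hE w) (fun u => hY s(w, u.1)) (hr w hw) (h w hw)
  refine conj_zzOp_eq_smul (fun w => ?_) ?_
  · have hwv : w.1 ≠ v := (G.ne_of_adj w.2).symm
    have := (hloc w.1 hwv).1 ⟨v, G.adj_symm w.2⟩
    simp only [Sym2.eq_swap (a := w.1)] at this
    exact this
  · have hall := prod_darts_eq_one (G := G) (fun e => if E e then flipSign (Y e) else 1) (by
      intro e
      split_ifs
      · exact flipSign_mul_self _
      · exact one_mul 1)
    rwa [Fintype.prod_eq_single v fun w hw => (hloc w hw).2] at hall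

theorem conj_edgeOp_mul {v : V} (Y X : Sym2 V → Matrix (Fin 2) (Fin 2) ℂ) (H : NodeOp G v) :
    (edgeOp (fun e => Y e * X e) v : NodeOp G v)ᴴ * H * edgeOp (fun e => Y e * X e) v =
      (edgeOp X v)ᴴ * ((edgeOp Y v)ᴴ * H * edgeOp Y v) * edgeOp X v := by
  rw [← edgeOp_mul, Matrix.conjTranspose_mul]
  simp only [mul_assoc]

theorem conj_injective {n : Type*} [Fintype n] [DecidableEq n] {A B C : Matrix n n ℂ}
    (hA : IsUnit A) (h : Aᴴ * B * A = Aᴴ * C * A) : B = C := by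
  have hA' : IsUnit Aᴴ := hA.star
  exact hA'.mul_left_cancel (hA.mul_right_cancel h)

open scoped ComplexOrder in
/-- If a state is transformed deterministically into `⨂ h Ψ` then it has the same local
moduli as the target, up to symmetries of `Ψ`. -/
theorem orbit_of_LOCCTo
    (hE : ∀ v, CycleType (fun w : G.neighborSet v => E s(v, w.1)) (β v) (a v))
    {h : ∀ v, NodeOp G v} (hu : ∀ v, IsUnit (h v))
    (hH : ∀ v, (h v)ᴴ * h v = edgeZZOp E β a v)
    {ι : V → Type u} {inst : ∀ v, Fintype (ι v)} {ψ : PureState ι}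
    (H : LOCCTo (applyLocal h (networkState G)) ι inst ψ) :
    ∀ A : ∀ v, Matrix (ι v) (NodeBasis G v) ℂ, ψ = applyLocal A (networkState G) →
      ψ = 0 ∨ ∃ (X : Sym2 V → Matrix (Fin 2) (Fin 2) ℂ) (r : V → ℂ), (∀ e, (X e).det ≠ 0) ∧
        (∀ v, r v ≠ 0) ∧
        ∀ v, (A v)ᴴ * A v = r v • ((edgeOp X v)ᴴ * edgeZZOp E β a v * edgeOp X v) := by
  induction H with
  | done c hc =>
    intro A hA
    right
    have hstab : applyLocal (fun v => (h v)⁻¹ * A v) (networkState G) = c • networkState G := by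
      rw [← applyLocal_comp, ← hA, applyLocal_smul, applyLocal_comp]
      have : (fun v => (h v)⁻¹ * h v) = fun v => 1 := funext fun v =>
        Matrix.nonsing_inv_mul _ ((Matrix.isUnit_iff_isUnit_det _).1 (hu v))
      rw [this, applyLocal_one]
    obtain ⟨X, r, hX, hr, hD⟩ := exists_edgeOp_of_stabilizer hc hstab
    refine ⟨X, fun v => star (r v) * r v, hX, fun v => mul_ne_zero (star_ne_zero.2 (hr v)) (hr v),
      fun v => ?_⟩
    have hAv : A v = r v • (h v * edgeOp X v) := by
      rw [← Matrix.mul_smul, ← hD, ← mul_assoc,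
        Matrix.mul_nonsing_inv _ ((Matrix.isUnit_iff_isUnit_det _).1 (hu v)), one_mul]
    rw [hAv, Matrix.conjTranspose_smul, Matrix.conjTranspose_mul, Matrix.smul_mul, Matrix.mul_smul,
      smul_smul, ← hH]
    simp only [mul_assoc]
  | impossible ι inst => exact fun _ _ => Or.inl rfl
  | round ι inst ψ v m κ inst' M hmeas hiso _ ih =>
    classical
    intro A hA
    by_cases hψ : ψ = 0
    · exact Or.inl hψ
    right
    have hbranch : ∀ k, applyLocal (M k) ψ =
        applyLocal (fun w => M k w * A w) (networkState G) := fun k => by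
      rw [hA, applyLocal_comp]
    have ih := fun k => ih k (fun w => M k w * A w) (hbranch k)
    have hside : ∀ k w, w ≠ v → (M k w * A w)ᴴ * (M k w * A w) = (A w)ᴴ * A w := by
      intro k w hw
      have := hiso k w hw
      unfold IsIsometry at this
      rw [Matrix.conjTranspose_mul, Matrix.mul_assoc, ← Matrix.mul_assoc (M k w)ᴴ, this,
        Matrix.one_mul]
    obtain ⟨k₀, hk₀⟩ : ∃ k, applyLocal (M k) ψ ≠ 0 := by
      by_contra! hcon
      exact hψ (eq_zero_of_branches_eq_zero hmeas hiso hcon)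
    obtain ⟨X₀, r₀, hX₀, hr₀, hA₀⟩ := (ih k₀).resolve_left hk₀
    have hAw : ∀ w, w ≠ v → (A w)ᴴ * A w =
        r₀ w • ((edgeOp X₀ w)ᴴ * edgeZZOp E β a w * edgeOp X₀ w) := fun w hw => by
      rw [← hside k₀ w hw, hA₀]
    have hZ : ∀ w, IsUnit (edgeZZOp E β a w : NodeOp G w) := fun w => by
      rw [← hH]
      exact (hu w).star.mul (hu w)
    have hk : ∀ k, ∃ s : ℂ, (M k v * A v)ᴴ * (M k v * A v) =
        s • ((edgeOp X₀ v)ᴴ * edgeZZOp E β a v * edgeOp X₀ v) := by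
      intro k
      rcases ih k with h0 | ⟨X, r, hX, hr, hAk⟩
      · refine ⟨0, ?_⟩
        rw [zero_smul]
        let B : ∀ w, Matrix (κ k w) (NodeBasis G w) ℂ := fun w => M k w * A w
        -- Left inverses at the other nodes reduce an outcome of probability zero to an operator at
        -- `v` alone, so that its modulus at `v` is 0.
        let L : ∀ w, Matrix (NodeBasis G w) (κ k w) ℂ := fun w =>
          if w = v then (B w)ᴴ else ((B w)ᴴ * B w)⁻¹ * (B w)ᴴ
        have h1 : applyLocal (fun w => L w * B w) (networkState G) = 0 := by
          rw [← applyLocal_comp, ← hbranch, h0, applyLocal_zero]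
        have h2 := eq_zero_of_applyLocal_eq_zero (v := v) (fun w hw => ?_) h1
        · simpa only [L, if_pos] using h2
        · simp only [L, if_neg hw]
          rw [Matrix.mul_assoc, Matrix.nonsing_inv_mul]
          rw [← Matrix.isUnit_iff_isUnit_det, hside k w hw, hAw w hw]
          have hX₀w : IsUnit (edgeOp X₀ w : NodeOp G w) := isUnit_edgeOp hX₀ w
          exact ((isUnit_iff_ne_zero.2 (hr₀ w)).map (algebraMap ℂ (NodeOp G w))).mul
            ((hX₀w.star.mul (hZ w)).mul hX₀w) |> fun hh => by
              rwa [← Algebra.smul_def] at hh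
      -- Away from `v` the moduli agree in the branches `k` and `k₀`, so `Y` preserves the target
      -- moduli there up to scalars.
      · let Y : Sym2 V → Matrix (Fin 2) (Fin 2) ℂ := fun e => X e * (X₀ e)⁻¹
        have hYX : (fun e => Y e * X₀ e) = X := funext fun e => by
          simp only [Y]
          rw [mul_assoc, Matrix.nonsing_inv_mul _ (isUnit_iff_ne_zero.2 (hX₀ e)), mul_one]
        have hY : ∀ e, (Y e).det ≠ 0 := fun e => by
          have := hX e
          rw [← hYX, Matrix.det_mul] at this
          exact left_ne_zero_of_mul this
        have hconj : ∀ w, (edgeOp X w : NodeOp G w)ᴴ * edgeZZOp E β a w * edgeOp X w =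
            (edgeOp X₀ w)ᴴ * ((edgeOp Y w)ᴴ * edgeZZOp E β a w * edgeOp Y w) * edgeOp X₀ w := by
          intro w
          rw [← conj_edgeOp_mul, hYX]
        obtain ⟨ρ, hρ⟩ := conj_edgeZZOp_eq_smul_of_forall_ne (G := G) hE hY (v := v)
          (r := fun w => r₀ w / r w) (fun w _ => div_ne_zero (hr₀ w) (hr w)) fun w hw => by
            refine conj_injective (isUnit_edgeOp hX₀ w) ?_
            rw [← hconj, Matrix.mul_smul, Matrix.smul_mul, div_eq_inv_mul, ← smul_smul, ← hAw w hw,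
              ← hside k w hw, hAk, smul_smul, inv_mul_cancel₀ (hr w), one_smul]
        refine ⟨r v * ρ, ?_⟩
        rw [hAk, hconj, hρ, Matrix.mul_smul, Matrix.smul_mul, smul_smul]
    choose s hs using hk
    have hAv : (A v)ᴴ * A v =
        (∑ k, s k) • ((edgeOp X₀ v)ᴴ * edgeZZOp E β a v * edgeOp X₀ v) := by
      unfold IsMeasurement at hmeas
      rw [Finset.sum_smul, ← Matrix.mul_one (A v)ᴴ, ← hmeas, Matrix.mul_sum, Matrix.sum_mul]
      refine Finset.sum_congr rfl fun k _ => ?_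
      rw [← hs, Matrix.conjTranspose_mul]
      simp only [Matrix.mul_assoc]
    have hs0 : ∑ k, s k ≠ 0 := by
      intro h0
      rw [h0, zero_smul, Matrix.conjTranspose_mul_self_eq_zero] at hAv
      exact hψ (by rw [hA, applyLocal_eq_zero_of_factor _ _ hAv])
    refine ⟨X₀, Function.update r₀ v (∑ k, s k), hX₀, fun w => ?_, fun w => ?_⟩
    · by_cases hw : w = v
      · subst hw
        rwa [Function.update_self]
      · rw [Function.update_of_ne hw]
        exact hr₀ w
    · by_cases hw : w = v
      · subst hw
        rw [Function.update_self, hAv]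
      · rw [Function.update_of_ne hw, hAw w hw]

theorem not_finiteRoundLOCC_of_edgeZZOp
    (hE : ∀ v, CycleType (fun w : G.neighborSet v => E s(v, w.1)) (β v) (a v))
    {v w : V} (hvw : G.Adj v w) (hEvw : E s(v, w))
    {h : ∀ v, NodeOp G v} (hu : ∀ v, IsUnit (h v))
    (hH : ∀ v, (h v)ᴴ * h v = edgeZZOp E β a v) :
    ¬ FiniteRoundLOCC (networkState G) (applyLocal h (networkState G)) := by
  intro H
  obtain ⟨X, r, hX, -, hA⟩ := (orbit_of_LOCCTo hE hu hH H (fun v => 1)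
    (applyLocal_one _).symm).resolve_left networkState_ne_zero'
  have := hA v
  rw [Matrix.conjTranspose_one, one_mul] at this
  exact conj_zzOp_ne_one (hE v) (u := ⟨w, hvw⟩) hEvw (fun u => hX s(v, u.1)) (r v) this.symm

theorem zzOp_diag {v : V} (C : G.neighborSet v → Prop) [DecidablePred C] (β a : ℝ)
    (x : NodeBasis G v) : zzOp C β a x x =
      β + a * ∏ w, (if C w then pauliZ else 1 : Matrix (Fin 2) (Fin 2) ℂ) (x w) (x w) := by
  simp [zzOp_apply]

theorem zzOp_diag_ne_zero {v : V} {C : G.neighborSet v → Prop} [DecidablePred C] {β a : ℝ}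
    (h : IsUnit (zzOp C β a)) (x : NodeBasis G v) : zzOp C β a x x ≠ 0 := by
  intro h0
  rw [Matrix.isUnit_iff_isUnit_det, isUnit_iff_ne_zero] at h
  refine h (Matrix.det_eq_zero_of_column_eq_zero x fun y => ?_)
  by_cases hyx : y = x
  · rw [hyx, h0]
  · obtain ⟨w, hw⟩ := Function.ne_iff.1 hyx
    have h1 : (1 : Matrix (Fin 2) (Fin 2) ℂ) (y w) (x w) = 0 := Matrix.one_apply_ne hw
    have h2 : (if C w then pauliZ else 1 : Matrix (Fin 2) (Fin 2) ℂ) (y w) (x w) = 0 := ?_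
    · rw [zzOp_apply]
      refine (congrArg₂ (· + ·)
        (mul_eq_zero_of_right _ (Finset.prod_eq_zero (Finset.mem_univ w) h1))
        (mul_eq_zero_of_right _ (Finset.prod_eq_zero (Finset.mem_univ w) h2))).trans (add_zero 0)
    split_ifs
    · have hz : ∀ i j : Fin 2, i ≠ j → pauliZ i j = 0 := by
        intro i j hij
        fin_cases i <;> fin_cases j <;> simp_all [pauliZ]
      exact hz _ _ hw
    · exact h1

/-- β + a and β - a are diagonal entries of an invertible diagonal operator: at the zero
configuration, and with one qubit of `C` flipped. -/
theorem cycleType_of_isUnit {v : V} {C : G.neighborSet v → Prop} [DecidablePred C] {β a : ℝ}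
    (hβ : β ≠ 0) (ha : a ≠ 0) (h : IsUnit (zzOp C β a)) {u u' : G.neighborSet v} (huu : u ≠ u')
    (hC : ∀ w, C w ↔ w = u ∨ w = u') : CycleType C β a := by
  have h0 := zzOp_diag_ne_zero h 0
  have h1 := zzOp_diag_ne_zero h (Function.update 0 u 1)
  rw [zzOp_diag] at h0 h1
  have e0 : ∏ w, (if C w then pauliZ else 1 : Matrix (Fin 2) (Fin 2) ℂ)
      ((0 : NodeBasis G v) w) ((0 : NodeBasis G v) w) = 1 := by
    refine Finset.prod_eq_one fun w _ => ?_
    split_ifs <;> simp [pauliZ]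
  have e1 : ∏ w, (if C w then pauliZ else 1 : Matrix (Fin 2) (Fin 2) ℂ)
      (Function.update (0 : NodeBasis G v) u 1 w) (Function.update (0 : NodeBasis G v) u 1 w) =
        -1 := by
    rw [Fintype.prod_eq_single u]
    · rw [if_pos ((hC u).2 (Or.inl rfl)), Function.update_self]
      simp [pauliZ]
    · intro w hw
      rw [Function.update_of_ne hw]
      split_ifs <;> simp [pauliZ]
  rw [e0, mul_one] at h0
  rw [e1, mul_neg_one, ← sub_eq_add_neg] at h1
  exact ⟨by exact_mod_cast h0, Or.inr ⟨hβ, ha, by exact_mod_cast h1, u, u', huu, hC⟩⟩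

theorem not_finiteRoundLOCC_of_isCycle {s : V} {c : G.Walk s s} (hc : c.IsCycle) {α : V → ℝ}
    (hα : ∀ v ∈ c.support, α v ≠ 0) {h : ∀ v, NodeOp G v}
    (hh : ∀ v, v ∈ c.support → IsUnit (h v) ∧ (h v)ᴴ * h v = cycleOp c v (α v))
    (hh' : ∀ v, v ∉ c.support → h v = 1) :
    ¬ FiniteRoundLOCC (networkState G) (applyLocal h (networkState G)) := by
  classical
  have hu : ∀ v, IsUnit (h v) := fun v => by
    by_cases hv : v ∈ c.support
    · exact (hh v hv).1
    · rw [hh' v hv]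
      exact isUnit_one
  -- Off the cycle, β = 1 and a = 0 give the identity, so all nodes have the same form.
  let β : V → ℝ := fun v => if v ∈ c.support then 1 / 4 else 1
  let a : V → ℝ := fun v => if v ∈ c.support then α v else 0
  have hH : ∀ v, (h v)ᴴ * h v = edgeZZOp (fun e => e ∈ c.edges) β a v := by
    intro v
    by_cases hv : v ∈ c.support
    · rw [(hh v hv).2, edgeZZOp, zzOp, cycleOp]
      simp [β, a, hv]
    · rw [hh' v hv, edgeZZOp, zzOp]
      simp [β, a, hv]
  have hmem : ∀ v (w : G.neighborSet v), s(v, w.1) ∈ c.edges ↔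
      w.1 ∈ c.toSubgraph.neighborSet v := fun v w =>
    (SimpleGraph.Walk.mem_edges_toSubgraph c).symm.trans Iff.rfl
  have hpair : ∀ v ∈ c.support, ∃ u u' : G.neighborSet v, u ≠ u' ∧
      ∀ w : G.neighborSet v, s(v, w.1) ∈ c.edges ↔ w = u ∨ w = u' := by
    intro v hv
    obtain ⟨u, u', huu, hset⟩ := Set.ncard_eq_two.1 (hc.ncard_neighborSet_toSubgraph_eq_two hv)
    have h1 : u ∈ c.toSubgraph.neighborSet v := by rw [hset]; simp
    have h2 : u' ∈ c.toSubgraph.neighborSet v := by rw [hset]; simp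
    refine ⟨⟨u, c.toSubgraph.adj_sub h1⟩, ⟨u', c.toSubgraph.adj_sub h2⟩,
      fun he => huu (congrArg Subtype.val he), fun w => ?_⟩
    rw [hmem, hset, Set.mem_insert_iff, Set.mem_singleton_iff, Subtype.ext_iff, Subtype.ext_iff]
  have hE : ∀ v, CycleType (fun w : G.neighborSet v => s(v, w.1) ∈ c.edges) (β v) (a v) := by
    intro v
    by_cases hv : v ∈ c.support
    · obtain ⟨u, u', huu, hC⟩ := hpair v hv
      have hunit : IsUnit (edgeZZOp (fun e => e ∈ c.edges) β a v : NodeOp G v) := by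
        rw [← hH]
        exact (hu v).star.mul (hu v)
      refine cycleType_of_isUnit ?_ ?_ hunit huu hC
      · simp [β, hv]
      · simpa [a, hv] using hα v hv
    · refine ⟨by simp [β, a, hv], Or.inl fun w hw => hv ?_⟩
      exact SimpleGraph.Walk.fst_mem_support_of_mem_edges c hw
  obtain ⟨u, u', -, hC⟩ := hpair s c.start_mem_support
  exact not_finiteRoundLOCC_of_edgeZZOp hE u.2 ((hC u).2 (Or.inl rfl)) hu hH

end

/-! ### Pauli twirls and the protocol on a tree. -/

/-- The Pauli matrices `1`, `σ_x`, `σ_x σ_z`, `σ_z`. -/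
def pauli (j : Fin 4) : Matrix (Fin 2) (Fin 2) ℂ :=
  match j with
  | 0 => 1
  | 1 => !![0, 1; 1, 0]
  | 2 => !![0, -1; 1, 0]
  | 3 => pauliZ

theorem pauli_isometry (j : Fin 4) : (pauli j)ᴴ * pauli j = 1 := by
  ext i k
  fin_cases j <;> fin_cases i <;> fin_cases k <;>
    simp [pauli, pauliZ, Matrix.mul_apply, Fin.sum_univ_two]

theorem det_pauli_ne_zero (j : Fin 4) : (pauli j).det ≠ 0 := by
  fin_cases j <;> simp [pauli, pauliZ, Matrix.det_fin_two]

theorem sum_pauli (i k i' k' : Fin 2) : ∑ j, star (pauli j i k) * pauli j i' k' =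
    2 * ((1 : Matrix (Fin 2) (Fin 2) ℂ) i i' * (1 : Matrix (Fin 2) (Fin 2) ℂ) k k') := by
  simp only [Fin.sum_univ_four]
  fin_cases i <;> fin_cases k <;> fin_cases i' <;> fin_cases k' <;>
    norm_num [pauli, pauliZ]

/-- For `w` farthest in `S` from some `t ∈ S`, a neighbour off the path from `t` to `w` would be
farther still; only the penultimate vertex of that path can lie in `S`. -/
theorem exists_adj_unique_of_isTree {V : Type u} [Fintype V] {G : SimpleGraph V} (hG : G.IsTree)
    {S : Finset V} (hS : S.Nonempty) : ∃ w ∈ S, ∃ p, ∀ u ∈ S, G.Adj w u → u = p := by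
  obtain ⟨t, ht⟩ := hS
  obtain ⟨w, hw, hmax⟩ := S.exists_max_image (fun w => G.dist t w) ⟨t, ht⟩
  obtain ⟨q, hq, -⟩ := (hG.connected t w).exists_path_of_dist
  refine ⟨w, hw, q.penultimate, fun u hu hwu => ?_⟩
  obtain ⟨p, hp, hp'⟩ := (hG.connected t u).exists_path_of_dist
  refine hG.isAcyclic.eq_penultimate_of_adj_end hq hwu ?_
  refine hG.isAcyclic.mem_support_of_ne_mem_support_of_adj_of_isPath hq hp hwu fun hwp => ?_
  have h1 := hG.isAcyclic.path_concat hq hp hwu hwp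
  have h2 := congrArg SimpleGraph.Walk.length h1
  rw [SimpleGraph.Walk.length_concat, hp'] at h2
  have h3 := SimpleGraph.dist_le q
  have h4 := hmax u hu
  omega

section

variable {V : Type u} [Fintype V] [LinearOrder V] {G : SimpleGraph V} [DecidableRel G.Adj] {w : V}

/-- The Pauli strings on the qubits of `w` outside `S`. -/
def pauliStrings (S : G.neighborSet w → Prop) [DecidablePred S] :
    Finset (G.neighborSet w → Fin 4) :=
  Fintype.piFinset fun u => if S u then {0} else Finset.univ

theorem eq_zero_of_mem_pauliStrings {S : G.neighborSet w → Prop} [DecidablePred S]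
    {f : G.neighborSet w → Fin 4} (hf : f ∈ pauliStrings S) {u : G.neighborSet w} (hu : S u) :
    f u = 0 := by
  have := Fintype.mem_piFinset.1 hf u
  rwa [if_pos hu, Finset.mem_singleton] at this

/-- The operator of a Pauli string. -/
noncomputable def pauliOp (f : G.neighborSet w → Fin 4) : NodeOp G w :=
  qubitTensor fun u => pauli (f u)

/-- Averaging over the Pauli strings outside `S`, up to a factor. -/
noncomputable def twirl (S : G.neighborSet w → Prop) [DecidablePred S] (X : NodeOp G w) :
    NodeOp G w :=
  ∑ f ∈ pauliStrings S, (pauliOp f)ᴴ * X * pauliOp f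

theorem twirl_apply (S : G.neighborSet w → Prop) [DecidablePred S] (X : NodeOp G w)
    (x x' : NodeBasis G w) : twirl S X x x' =
      (∏ u, if S u then 1 else (1 : Matrix (Fin 2) (Fin 2) ℂ) (x u) (x' u)) *
      ∑ y' : NodeBasis G w, ∑ y : NodeBasis G w, X y y' * ∏ u, if S u then
        (1 : Matrix (Fin 2) (Fin 2) ℂ) (y u) (x u) * (1 : Matrix (Fin 2) (Fin 2) ℂ) (y' u) (x' u)
        else 2 * (1 : Matrix (Fin 2) (Fin 2) ℂ) (y u) (y' u) := by
  have h1 : ∀ y y' : NodeBasis G w,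
      ∑ f ∈ pauliStrings S, star (pauliOp f y x) * pauliOp f y' x' =
      (∏ u, if S u then 1 else (1 : Matrix (Fin 2) (Fin 2) ℂ) (x u) (x' u)) *
        ∏ u, if S u then
        (1 : Matrix (Fin 2) (Fin 2) ℂ) (y u) (x u) * (1 : Matrix (Fin 2) (Fin 2) ℂ) (y' u) (x' u)
        else 2 * (1 : Matrix (Fin 2) (Fin 2) ℂ) (y u) (y' u) := by
    intro y y'
    simp only [pauliOp, qubitTensor_apply, star_prod, ← Finset.prod_mul_distrib, pauliStrings]
    rw [← Finset.prod_univ_sum (fun u => if S u then {0} else Finset.univ)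
      (fun u j => star (pauli j (y u) (x u)) * pauli j (y' u) (x' u))]
    refine Finset.prod_congr rfl fun u _ => ?_
    split_ifs
    · have h0 : ∀ i j, star (pauli 0 i j) = (1 : Matrix (Fin 2) (Fin 2) ℂ) i j := by
        intro i j
        fin_cases i <;> fin_cases j <;> simp [pauli]
      rw [Finset.sum_singleton, one_mul, h0]
      rfl
    · rw [sum_pauli]
      ring
  simp only [twirl, Matrix.sum_apply, Matrix.mul_apply, Matrix.conjTranspose_apply,
    Finset.sum_mul]
  rw [Finset.sum_comm, Finset.mul_sum]
  refine Finset.sum_congr rfl fun y' _ => ?_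
  rw [Finset.sum_comm, Finset.mul_sum]
  refine Finset.sum_congr rfl fun y _ => ?_
  rw [mul_left_comm, ← h1, Finset.mul_sum]
  refine Finset.sum_congr rfl fun f _ => ?_
  ring

theorem twirl_of_forall_not {S : G.neighborSet w → Prop} [DecidablePred S] (hS : ∀ u, ¬ S u)
    (X : NodeOp G w) : ∃ τ : ℂ, twirl S X = τ • 1 := by
  refine ⟨∑ y' : NodeBasis G w, ∑ y : NodeBasis G w, X y y' *
    ∏ u, 2 * (1 : Matrix (Fin 2) (Fin 2) ℂ) (y u) (y' u), ?_⟩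
  ext x x'
  rw [twirl_apply]
  simp only [hS, if_false]
  rw [Matrix.smul_apply, smul_eq_mul, mul_comm, ← qubitTensor_one]
  rfl

theorem twirl_of_iff_eq {S : G.neighborSet w → Prop} [DecidablePred S] {p : G.neighborSet w}
    (hS : ∀ u, S u ↔ u = p) (X : NodeOp G w) :
    ∃ ρ : Matrix (Fin 2) (Fin 2) ℂ, twirl S X = qubitTensor fun u => if u = p then ρ else 1 := by
  refine ⟨Matrix.of fun i j => ∑ y' : NodeBasis G w, ∑ y : NodeBasis G w, X y y' *
    ∏ u, if u = p then
      (1 : Matrix (Fin 2) (Fin 2) ℂ) (y u) i * (1 : Matrix (Fin 2) (Fin 2) ℂ) (y' u) j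
      else 2 * (1 : Matrix (Fin 2) (Fin 2) ℂ) (y u) (y' u), ?_⟩
  ext x x'
  rw [twirl_apply, qubitTensor_apply, ← Finset.mul_prod_erase _ _ (Finset.mem_univ p),
    ← Finset.mul_prod_erase _ _ (Finset.mem_univ p)]
  simp only [hS, if_true, one_mul, Matrix.of_apply]
  rw [mul_comm]
  congr 1
  · refine Finset.sum_congr rfl fun y' _ => Finset.sum_congr rfl fun y _ => ?_
    congr 1
    refine Finset.prod_congr rfl fun u _ => ?_
    by_cases hu : u = p
    · rw [if_pos hu, if_pos hu, hu]
    · rw [if_neg hu, if_neg hu]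
  · refine Finset.prod_congr rfl fun u hu => ?_
    rw [if_neg (Finset.mem_erase.1 hu).1, if_neg (Finset.mem_erase.1 hu).1]

theorem isUnit_pauliOp (f : G.neighborSet w → Fin 4) : IsUnit (pauliOp f) :=
  isUnit_qubitTensor fun _ => det_pauli_ne_zero _

open scoped ComplexOrder

theorem posDef_conjTranspose_mul_self_of_isUnit {n : Type*} [Fintype n] [DecidableEq n]
    {A : Matrix n n ℂ} (hA : IsUnit A) : (Aᴴ * A).PosDef :=
  Matrix.PosDef.conjTranspose_mul_self A (Matrix.mulVec_injective_of_isUnit hA)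

theorem posDef_twirl (S : G.neighborSet w → Prop) [DecidablePred S] {h : NodeOp G w}
    (hh : IsUnit h) : (twirl S (hᴴ * h)).PosDef := by
  refine Matrix.posDef_sum ⟨fun _ => 0, ?_⟩ fun f _ => ?_
  · refine Fintype.mem_piFinset.2 fun u => ?_
    split_ifs <;> simp
  · have := posDef_conjTranspose_mul_self_of_isUnit (hh.mul (isUnit_pauliOp f))
    rw [Matrix.conjTranspose_mul] at this
    simpa only [mul_assoc] using this

open scoped MatrixOrder in
theorem exists_conj_eq_one {ρ : Matrix (Fin 2) (Fin 2) ℂ} (hρ : ρ.PosDef) :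
    ∃ B : Matrix (Fin 2) (Fin 2) ℂ, B.det ≠ 0 ∧ Bᴴ * ρ * B = 1 := by
  obtain ⟨b, hb, rfl⟩ := CStarAlgebra.isStrictlyPositive_iff_eq_star_mul_self.mp
    hρ.isStrictlyPositive
  have hb' := (Matrix.isUnit_iff_isUnit_det _).1 hb
  refine ⟨b⁻¹, (Matrix.isUnit_nonsing_inv_det b hb').ne_zero, ?_⟩
  rw [Matrix.star_eq_conjTranspose, ← mul_assoc, ← Matrix.conjTranspose_mul,
    Matrix.mul_nonsing_inv _ hb', Matrix.conjTranspose_one, one_mul, Matrix.mul_nonsing_inv _ hb']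

/-- By a symmetry of the network state on an edge in `S`, an operator at `w` can be completed by
Pauli strings outside `S` to a generalised measurement. -/
theorem exists_gauge {S : G.neighborSet w → Prop} [DecidablePred S]
    (hS : (∀ u, ¬ S u) ∨ ∃ p, ∀ u, S u ↔ u = p) {h : NodeOp G w} (hh : IsUnit h) :
    ∃ (X : Sym2 V → Matrix (Fin 2) (Fin 2) ℂ) (r : ℂ), r ≠ 0 ∧ (∀ e, (X e).det ≠ 0) ∧
      (∀ e, X e ≠ 1 → ∃ p : G.neighborSet w, S p ∧ e = s(w, p.1)) ∧
      twirl S ((r • (h * edgeOp X w))ᴴ * (r • (h * edgeOp X w))) = 1 := by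
  have hpos := posDef_twirl S hh
  rcases hS with hS | ⟨p, hS⟩
  · obtain ⟨τ, hτ⟩ := twirl_of_forall_not hS (hᴴ * h)
    have hτ0 : 0 < τ := by
      have := hpos.diag_pos (i := 0)
      rwa [hτ, Matrix.smul_apply, Matrix.one_apply_eq, smul_eq_mul, mul_one] at this
    obtain ⟨t, ht, rfl⟩ : ∃ t : ℝ, 0 < t ∧ τ = t := by
      obtain ⟨h1, h2⟩ := Complex.pos_iff.1 hτ0
      exact ⟨τ.re, h1, Complex.ext rfl h2.symm⟩
    have hs : (√t : ℂ) ≠ 0 := by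
      exact_mod_cast (Real.sqrt_pos.2 ht).ne'
    refine ⟨fun _ => 1, (√t : ℂ)⁻¹, inv_ne_zero hs, by simp, fun e he => (he rfl).elim, ?_⟩
    have h2 : twirl S (((√t : ℂ)⁻¹ • (h * edgeOp (fun _ => 1) w))ᴴ *
        ((√t : ℂ)⁻¹ • (h * edgeOp (fun _ => 1) w))) =
        ((√t : ℂ)⁻¹ * (√t : ℂ)⁻¹) • twirl S (hᴴ * h) := by
      simp only [twirl, edgeOp_one, mul_one, Matrix.conjTranspose_smul, Matrix.mul_smul,
        Matrix.smul_mul, Finset.smul_sum, smul_smul]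
      simp
    rw [h2, hτ, smul_smul, ← mul_inv, ← Complex.ofReal_mul, Real.mul_self_sqrt ht.le,
      inv_mul_cancel₀ (by exact_mod_cast ht.ne'), one_smul]
  · obtain ⟨ρ, hρ⟩ := twirl_of_iff_eq hS (hᴴ * h)
    have hρpos : ρ.PosDef := by
      have h1 := hpos.submatrix (Function.update_injective (0 : NodeBasis G w) p)
      convert h1
      ext i j
      rw [Matrix.submatrix_apply, hρ, qubitTensor_apply,
        prod_update_one (fun u => if u = p then ρ else 1), if_pos rfl, Finset.prod_eq_one, mul_one]
      intro u hu
      rw [if_neg (Finset.mem_erase.1 hu).1, Matrix.one_apply_eq]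
    obtain ⟨B, hB, hBρ⟩ := exists_conj_eq_one hρpos
    let X : Sym2 V → Matrix (Fin 2) (Fin 2) ℂ := fun e => if e = s(w, p.1) then B else 1
    have hX : (edgeOp X w : NodeOp G w) = qubitTensor fun u => if u = p then B else 1 := by
      rw [edgeOp]
      congr 1
      funext u
      have : s(w, u.1) = s(w, p.1) ↔ u = p := by rw [Sym2.congr_right, Subtype.ext_iff]
      simp only [X, this]
    refine ⟨X, 1, one_ne_zero, fun e => ?_, fun e he => ⟨p, (hS p).2 rfl, ?_⟩, ?_⟩
    · simp only [X]
      split_ifs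
      · exact hB
      · simp
    · by_contra hne
      exact he (if_neg hne)
    -- The strings are trivial on the qubit `p`, the only one on which `X` acts at `w`.
    · have hcomm : ∀ f ∈ pauliStrings S, (edgeOp X w : NodeOp G w) * pauliOp f =
          pauliOp f * edgeOp X w := by
        intro f hf
        rw [hX, pauliOp, qubitTensor_mul, qubitTensor_mul]
        congr 1
        funext u
        by_cases hu : u = p
        · rw [eq_zero_of_mem_pauliStrings hf ((hS u).2 hu)]
          simp [pauli]
        · simp [hu]
      have h2 : twirl S (((1 : ℂ) • (h * edgeOp X w))ᴴ * ((1 : ℂ) • (h * edgeOp X w))) =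
          (edgeOp X w)ᴴ * twirl S (hᴴ * h) * edgeOp X w := by
        simp only [twirl, one_smul, Finset.mul_sum, Finset.sum_mul]
        refine Finset.sum_congr rfl fun f hf => ?_
        have h3 : (h * edgeOp X w) * pauliOp f = h * pauliOp f * edgeOp X w := by
          rw [mul_assoc, hcomm f hf, mul_assoc]
        calc (pauliOp f)ᴴ * ((h * edgeOp X w)ᴴ * (h * edgeOp X w)) * pauliOp f
            = ((h * edgeOp X w) * pauliOp f)ᴴ * ((h * edgeOp X w) * pauliOp f) := by
              rw [Matrix.conjTranspose_mul (h * edgeOp X w)]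
              simp only [mul_assoc]
          _ = _ := by
              rw [h3, Matrix.conjTranspose_mul, Matrix.conjTranspose_mul]
              simp only [mul_assoc]
      rw [h2, hρ, hX, qubitTensor_conjTranspose, qubitTensor_mul, qubitTensor_mul,
        ← qubitTensor_one]
      congr 1
      funext u
      split_ifs
      · exact hBρ
      · simp

open scoped Classical in
/-- The correction of the Pauli string `f` at `w`, on both qubits of each edge at `w`. -/
noncomputable def pauliEdges (f : G.neighborSet w → Fin 4) (e : Sym2 V) :
    Matrix (Fin 2) (Fin 2) ℂ :=
  if h : ∃ u : G.neighborSet w, e = s(w, u.1) then pauli (f h.choose) else 1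

theorem pauliEdges_apply (f : G.neighborSet w → Fin 4) (u : G.neighborSet w) :
    pauliEdges f s(w, u.1) = pauli (f u) := by
  have h : ∃ u' : G.neighborSet w, s(w, u.1) = s(w, u'.1) := ⟨u, rfl⟩
  rw [pauliEdges, dif_pos h]
  congr 2
  exact (Subtype.ext (Sym2.congr_right.1 h.choose_spec)).symm

theorem pauliEdges_spec (f : G.neighborSet w → Fin 4) (e : Sym2 V) :
    ∃ j, pauliEdges f e = pauli j := by
  rw [pauliEdges]
  split_ifs
  · exact ⟨_, rfl⟩
  · exact ⟨0, rfl⟩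

theorem edgeOp_pauliEdges_isometry (f : G.neighborSet w → Fin 4) (v : V) :
    (edgeOp (pauliEdges f) v : NodeOp G v)ᴴ * edgeOp (pauliEdges f) v = 1 := by
  rw [edgeOp, qubitTensor_conjTranspose, qubitTensor_mul, ← qubitTensor_one]
  congr 1
  funext u
  obtain ⟨j, hj⟩ := pauliEdges_spec f s(v, u.1)
  rw [hj, pauli_isometry]

theorem edgeOp_eq_one {X : Sym2 V → Matrix (Fin 2) (Fin 2) ℂ} {v : V}
    (h : ∀ u : G.neighborSet v, X s(v, u.1) = 1) : (edgeOp X v : NodeOp G v) = 1 := by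
  rw [edgeOp, ← qubitTensor_one]
  congr 1
  exact funext h

/-- One round of the protocol: node `w` applies its operator, and its neighbours outside `S` correct
the Pauli errors. -/
theorem LOCCTo_of_twirl_eq_one {S : Finset V} (hw : w ∉ S) {g : ∀ v, NodeOp G v}
    (hg : ∀ v, v ∉ S → v ≠ w → g v = 1)
    (htw : twirl (fun u : G.neighborSet w => u.1 ∈ S) ((g w)ᴴ * g w) = 1) :
    LOCCTo (applyLocal g (networkState G)) (NodeBasis G) inferInstance
      (applyLocal (Function.update g w 1) (networkState G)) := by
  classical
  let F := pauliStrings (fun u : G.neighborSet w => u.1 ∈ S)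
  let M : F → ∀ v, NodeOp G v := fun f =>
    Function.update (fun v => edgeOp (pauliEdges f.1) v) w (g w * pauliOp f.1)
  refine .round _ _ _ w _ (fun _ => NodeBasis G) (fun _ => inferInstance)
    (fun k => M (F.equivFin.symm k)) ?_ ?_ ?_
  · unfold IsMeasurement
    rw [Equiv.sum_comp F.equivFin.symm (fun f => (M f w)ᴴ * M f w)]
    simp only [M, Function.update_self]
    rw [Finset.sum_coe_sort F (fun f => (g w * pauliOp f)ᴴ * (g w * pauliOp f))]
    have key : ∑ f ∈ F, (g w * pauliOp f)ᴴ * (g w * pauliOp f) = 1 := by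
      rw [← htw]
      refine Finset.sum_congr rfl fun f _ => ?_
      rw [Matrix.conjTranspose_mul]
      simp only [mul_assoc]
    convert key
  · intro k v hv
    unfold IsIsometry
    simp only [M, Function.update_of_ne hv]
    convert edgeOp_pauliEdges_isometry (G := G) (F.equivFin.symm k).1 v
  · intro k
    set f := F.equivFin.symm k
    obtain ⟨c, hc, hfix⟩ := applyLocal_edgeOp (G := G) (pauliEdges f.1) fun e => by
      obtain ⟨j, hj⟩ := pauliEdges_spec f.1 e
      rw [hj]
      exact det_pauli_ne_zero j
    -- At nodes of `S` the correction is 1, because `f` is 0 on the qubits towards `S`; at the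
    -- remaining nodes `g` is 1. So the branch applies `g` after a symmetry of the network state.
    have hM : (fun v => M f v * Function.update g w 1 v) =
        fun v => g v * edgeOp (pauliEdges f.1) v := by
      funext v
      by_cases hv : v = w
      · subst hv
        simp only [M, Function.update_self, mul_one, edgeOp, pauliEdges_apply]
        rfl
      · simp only [M, Function.update_of_ne hv]
        by_cases hvS : v ∈ S
        · rw [edgeOp_eq_one, one_mul, mul_one]
          intro u
          rw [pauliEdges]
          split_ifs with hex
          · have hu := hex.choose_spec
            rcases Sym2.eq_iff.1 hu with ⟨h1, -⟩ | ⟨h1, -⟩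
            · exact (hv h1).elim
            · have h2 : hex.choose.1 ∈ S := h1 ▸ hvS
              rw [eq_zero_of_mem_pauliStrings (S := fun u : G.neighborSet w => u.1 ∈ S) f.2 h2]
              rfl
          · rfl
        · rw [hg v hvS hv, one_mul, mul_one]
    rw [applyLocal_comp, hM, ← applyLocal_comp, hfix, applyLocal_smul]
    exact .done c hc

theorem finiteRoundLOCC_of_isTree (hG : G.IsTree) (S : Finset V) :
    ∀ h : ∀ v, NodeOp G v, (∀ v, IsUnit (h v)) → (∀ v, v ∉ S → h v = 1) →
      FiniteRoundLOCC (networkState G) (applyLocal h (networkState G)) := by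
  induction S using Finset.strongInduction with
  | H S ih =>
    intro h hu hS
    rcases S.eq_empty_or_nonempty with rfl | hne
    · have : h = fun v => 1 := funext fun v => hS v (Finset.notMem_empty v)
      rw [this, applyLocal_one]
      have := LOCCTo.done (φ := networkState G) 1 one_ne_zero
      rwa [one_smul] at this
    · obtain ⟨w, hw, p, hp⟩ := exists_adj_unique_of_isTree hG hne
      have hS' : (∀ u : G.neighborSet w, ¬ u.1 ∈ S.erase w) ∨
          ∃ p : G.neighborSet w, ∀ u : G.neighborSet w, u.1 ∈ S.erase w ↔ u = p := by
        by_cases hex : ∃ u : G.neighborSet w, u.1 ∈ S.erase w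
        · obtain ⟨u₀, hu₀⟩ := hex
          refine Or.inr ⟨u₀, fun u => ⟨fun hu => Subtype.ext ?_, fun hu => hu ▸ hu₀⟩⟩
          rw [hp u.1 (Finset.mem_of_mem_erase hu) u.2, hp u₀.1 (Finset.mem_of_mem_erase hu₀) u₀.2]
        · push Not at hex
          exact Or.inl hex
      obtain ⟨X, r, hr, hX, hXS, htw⟩ := exists_gauge hS' (hu w)
      obtain ⟨c, hc, hfix⟩ := applyLocal_edgeOp (G := G) X hX
      let d : V → ℂ := fun v => if v = w then r else 1
      have hd : ∀ v, d v ≠ 0 := fun v => by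
        simp only [d]
        split_ifs
        · exact hr
        · exact one_ne_zero
      -- The target in the new gauge: the same state up to a scalar. Besides `w`, only the neighbour
      -- of `w` in `S` has its operator changed.
      let g : ∀ v, NodeOp G v := fun v => d v • (h v * edgeOp X v)
      have hgw : g w = r • (h w * edgeOp X w) := by simp [g, d]
      have hgΨ : applyLocal g (networkState G) =
          ((∏ v, d v) * c) • applyLocal h (networkState G) := by
        rw [applyLocal_smul_factors, ← applyLocal_comp, hfix, applyLocal_smul, smul_smul]
      have hg1 : ∀ v, v ∉ S.erase w → v ≠ w → g v = 1 := by
        intro v hv hvw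
        have hvS : v ∉ S := fun hh => hv (Finset.mem_erase.2 ⟨hvw, hh⟩)
        have hXv : (edgeOp X v : NodeOp G v) = 1 := edgeOp_eq_one fun u => by
          by_contra hne
          obtain ⟨q, hq, he⟩ := hXS _ hne
          rcases Sym2.eq_iff.1 he with ⟨h1, -⟩ | ⟨h1, -⟩
          · exact hvw h1
          · exact hv (h1 ▸ hq)
        simp only [g, d, if_neg hvw, hXv, hS v hvS, one_smul, mul_one]
      have hgu : ∀ v, IsUnit (g v) := fun v => by
        have h1 : IsUnit (h v * edgeOp X v) := (hu v).mul (isUnit_edgeOp hX v)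
        have h2 := ((isUnit_iff_ne_zero.2 (hd v)).map (algebraMap ℂ (NodeOp G v))).mul h1
        rwa [← Algebra.smul_def] at h2
      -- The nodes of `S.erase w` act before `w` does.
      have hstart := ih (S.erase w) (Finset.erase_ssubset hw) (Function.update g w 1)
        (fun v => by
          by_cases hv : v = w
          · subst hv
            rw [Function.update_self]
            exact isUnit_one
          · rw [Function.update_of_ne hv]
            exact hgu v)
        (fun v hv => by
          by_cases hvw : v = w
          · subst hvw
            rw [Function.update_self]
          · rw [Function.update_of_ne hvw]
            exact hg1 v hv hvw)
      have hstep := LOCCTo_of_twirl_eq_one (Finset.notMem_erase w S) hg1 (by rw [hgw]; exact htw)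
      have hend : LOCCTo (applyLocal h (networkState G)) (NodeBasis G) inferInstance
          (applyLocal g (networkState G)) := by
        rw [hgΨ]
        exact .done _ (mul_ne_zero (Finset.prod_ne_zero_iff.2 fun v _ => hd v) hc)
      exact (LOCCTo.trans hstart hstep).trans hend

end

end QNetwork

theorem mainTheorem2 {V : Type u} [Fintype V] [LinearOrder V] (G : SimpleGraph V)
    [DecidableRel G.Adj] :
    (∀ (s : V) (c : G.Walk s s), c.IsCycle →
      ∀ α : V → ℝ, 0 < ∏ v ∈ c.support.toFinset, α v →
      ∀ h : ∀ v, QNetwork.NodeOp G v,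
        (∀ v, v ∈ c.support → IsUnit (h v) ∧ (h v)ᴴ * h v = QNetwork.cycleOp c v (α v)) →
        (∀ v, v ∉ c.support → h v = 1) →
        ¬ QNetwork.FiniteRoundLOCC (QNetwork.networkState G)
            (QNetwork.applyLocal h (QNetwork.networkState G))) ∧
    (G.IsTree →
      ∀ h : ∀ v, QNetwork.NodeOp G v, (∀ v, IsUnit (h v)) →
        QNetwork.FiniteRoundLOCC (QNetwork.networkState G)
          (QNetwork.applyLocal h (QNetwork.networkState G))) := by
  refine ⟨fun s c hc α hα h hh hh' => ?_, fun hG h hu => ?_⟩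
  · refine QNetwork.not_finiteRoundLOCC_of_isCycle hc (fun v hv => ?_) hh hh'
    exact Finset.prod_ne_zero_iff.1 hα.ne' v (List.mem_toFinset.2 hv)
  · exact QNetwork.finiteRoundLOCC_of_isTree hG Finset.univ h hu fun v hv =>
      (hv (Finset.mem_univ v)).elim
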